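/- **Theorem.** There are absolute constants $\varepsilon>0$ and $p_0$ (explicitly, $\varepsilon=10^{-4}$ and $p_0=2^{94}$ are admissible) with the following property. Let $p>p_0$ be a prime, let $S\subset\mathbb Z/p\mathbb Z$, write $2S=\{s+s' : s,s'\in S\}$, and put $m=|2S|-2|S|$. If $|2S|<(2+\varepsilon)|S|$ and $$-1\le m\le\min\{|S|-4,\;p-|2S|-3\},$$ then $S$ is contained in an arithmetic progression of $\mathbb Z/p\mathbb Z$ of length (that is, cardinality) $|S|+m+1$. -/

import Mathlib

open scoped Pointwise

/-- `P ⊆ ℤ/pℤ` is an arithmetic progression of length `n`: it has exactly `n` elements, and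
they are `a, a + d, …, a + (n - 1) d` for some `a, d`. (So `d ≠ 0` as soon as `n ≥ 2`.) -/
def IsArithProgOfLength {p : ℕ} (P : Finset (ZMod p)) (n : ℕ) : Prop :=
  P.card = n ∧ ∃ a d : ZMod p, P = (Finset.range n).image (fun i : ℕ => a + (i : ZMod p) * d)

/-! Since |S| + m + 1 = |2S| - |S| + 1, a progression with |2S| - |S| + 1 terms is sought. If |S| ≤
47 (pigeonhole on dilates) or |S| ≤ p/200 (a large Fourier coefficient puts over 80% of a dilate of
S on a half circle), then S is Freiman isomorphic to a set of integers. There a doubling below 5/2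
gives the sharp length, because adding A modulo its own length l gains at least about |A|/2 residues
each time (`two_mul_card_add_ge_of_closure_eq_top`).

For denser S the structure is found in a smaller set X with |X + S| - |X| ≤ |2S| - |S|. Let k = p -
|2S|. If k < |S|/1000, take X = -(2S)ᶜ: then X + S avoids -S. Otherwise X is an isoperimetric atom
of S. In both cases |X + S| ≤ |S| + g with g at most 2|X|, respectively 1.1|X|. Plünnecke–Petridis
combined with Cauchy–Davenport bounds |jX| by about jg, and a large exponential sum puts nearly all
of X on a short arc. Hence X is an affine copy of an integer set A ⊆ [0, l] with l at most a small
multiple of |X|.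

Rescale S to B and let D be the complement of A + B; at most g points lie outside B ∪ D. A window of
a few lengths l that begins with a point of B and ends with a point of D contains many points
outside B ∪ D, because the residues of B modulo l spread under addition of A
(`IsNormalized.exists_residue_chain`). Too many such windows would exceed g, so B has a gap of
length l, and D has one inside the span of B. Then A + B does not wrap around and contains l
consecutive integers, and `length_add_card_le_of_Ico_subset` gives the sharp bound for the span of
S. -/

section Isoperimetric

/-! ### Isoperimetric atoms in finite abelian groups. -/

variable {G : Type*} [AddCommGroup G] [Fintype G] [DecidableEq G]

/-- A smallest minimiser of `|X + S| - |X|` among the sets with `|X| ≥ k` and `|X + S| ≤ |G| - k`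
meets each of its other translates in fewer than `k` elements. -/
theorem exists_isoperimetric_atom (S : Finset G) (k : ℕ)
    (hF : ∃ X : Finset G, k ≤ X.card ∧ (X + S).card + k ≤ Fintype.card G) :
    ∃ X : Finset G, k ≤ X.card ∧ (X + S).card + k ≤ Fintype.card G ∧
      (∀ Z : Finset G, k ≤ Z.card → (Z + S).card + k ≤ Fintype.card G →
        (X + S).card + Z.card ≤ (Z + S).card + X.card) ∧
      ∀ t : G, t +ᵥ X = X ∨ (X ∩ (t +ᵥ X)).card < k := by
  classical
  let F : Finset (Finset G) := Finset.univ.filter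
    (fun X => k ≤ X.card ∧ (X + S).card + k ≤ Fintype.card G)
  have memF : ∀ X, X ∈ F ↔ (k ≤ X.card ∧ (X + S).card + k ≤ Fintype.card G) := by
    intro X; simp [F]
  obtain ⟨X₀, hX₀, hmin₀⟩ := Finset.exists_min_image F
    (fun X => ((X + S).card : ℤ) - X.card) (by
      obtain ⟨X, hX⟩ := hF
      exact ⟨X, (memF X).2 hX⟩)
  obtain ⟨X, hX, hmin⟩ := Finset.exists_min_image
    (F.filter (fun X => ((X + S).card : ℤ) - X.card = ((X₀ + S).card : ℤ) - X₀.card))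
    (fun X => X.card) ⟨X₀, by simp [hX₀]⟩
  rw [Finset.mem_filter] at hX
  obtain ⟨hXF, hXe⟩ := hX
  have hXm : ∀ Z ∈ F, ((X + S).card : ℤ) - X.card ≤ ((Z + S).card : ℤ) - Z.card := by
    intro Z hZ
    rw [hXe]
    exact hmin₀ Z hZ
  have hXs : ∀ Z ∈ F, ((Z + S).card : ℤ) - Z.card ≤ ((X + S).card : ℤ) - X.card →
      X.card ≤ Z.card := by
    intro Z hZ h
    apply hmin
    rw [Finset.mem_filter]
    refine ⟨hZ, ?_⟩
    have := hXm Z hZ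
    omega
  have hXF' := (memF X).1 hXF
  -- Duality: -(X + S)ᶜ is admissible with no larger excess |Z + S| - |Z|, hence has at least |X|
  -- elements. This is what keeps X ∪ (t + X) admissible below.
  have hdual : X.card ≤ Fintype.card G - (X + S).card := by
    have hcard : (-((X + S)ᶜ)).card = Fintype.card G - (X + S).card := by
      rw [Finset.card_neg, Finset.card_compl]
    have hle := Finset.card_le_univ (X + S)
    have hsub : -((X + S)ᶜ) + S ⊆ (-X)ᶜ := by
      intro z hz
      rw [Finset.mem_add] at hz
      obtain ⟨y, hy, s, hs, rfl⟩ := hz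
      rw [Finset.mem_neg'] at hy
      rw [Finset.mem_compl, Finset.mem_neg']
      intro hx
      rw [Finset.mem_compl] at hy
      apply hy
      rw [Finset.mem_add]
      exact ⟨_, hx, s, hs, by abel⟩
    have hle2 := Finset.card_le_card hsub
    rw [Finset.card_compl, Finset.card_neg] at hle2
    have hXle := Finset.card_le_univ X
    rw [← hcard]
    apply hXs
    · rw [memF, hcard]
      omega
    · rw [hcard]
      omega
  refine ⟨X, hXF'.1, hXF'.2, ?_, ?_⟩
  · intro Z h1 h2
    have := hXm Z ((memF Z).2 ⟨h1, h2⟩)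
    omega
  · intro t
    by_contra! hcon
    obtain ⟨hne, hk⟩ := hcon
    have hVX : (X ∩ (t +ᵥ X)).card < X.card := by
      apply Finset.card_lt_card
      refine ⟨Finset.inter_subset_left, fun h => hne ?_⟩
      symm
      apply Finset.eq_of_subset_of_card_le
      · exact h.trans Finset.inter_subset_right
      · rw [Finset.card_vadd_finset]
    -- Submodularity: the excesses of union and intersection add up to at most twice that of X. The
    -- intersection is admissible and smaller than X, so its excess is strictly larger; the union
    -- then falls below the minimum.
    have hU : (X ∪ (t +ᵥ X)) + S = (X + S) ∪ (t +ᵥ (X + S)) := by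
      rw [Finset.union_add, ← vadd_add_assoc]
    have hV : (X ∩ (t +ᵥ X)) + S ⊆ (X + S) ∩ (t +ᵥ (X + S)) := by
      rw [← vadd_add_assoc]
      exact Finset.inter_add_subset
    have c1 := Finset.card_union_add_card_inter X (t +ᵥ X)
    have c2 := Finset.card_union_add_card_inter (X + S) (t +ᵥ (X + S))
    rw [Finset.card_vadd_finset] at c1 c2
    have c3 := Finset.card_le_card hV
    rw [← hU] at c2
    have hVS : ((X ∩ (t +ᵥ X)) + S).card ≤ (X + S).card :=
      Finset.card_le_card (Finset.add_subset_add_right Finset.inter_subset_left)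
    have hVF : X ∩ (t +ᵥ X) ∈ F := (memF _).2 ⟨hk, by omega⟩
    have e1 := hXm _ hVF
    have e2 : ¬ (((X ∩ (t +ᵥ X) + S).card : ℤ) - (X ∩ (t +ᵥ X)).card
        ≤ ((X + S).card : ℤ) - X.card) := fun h => by
      have := hXs _ hVF h
      omega
    have hUF : X ∪ (t +ᵥ X) ∈ F := by
      rw [memF]
      constructor <;> omega
    have e3 := hXm _ hUF
    omega

/-- A generating set `A ∋ 0` of a finite abelian group enlarges every set by at least `|A| / 2`
until the whole group is filled. -/
theorem two_mul_card_add_ge_of_closure_eq_top (A P : Finset G) (h0 : (0 : G) ∈ A)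
    (hA : AddSubgroup.closure (A : Set G) = ⊤) (hP : P.Nonempty) :
    P + A = Finset.univ ∨ 2 * P.card + A.card ≤ 2 * (P + A).card := by
  classical
  by_cases hPA : P + A = Finset.univ
  · exact Or.inl hPA
  right
  have hPA' : (P + A).card + 1 ≤ Fintype.card G := by
    have := (Finset.card_lt_iff_ne_univ (P + A)).2 hPA
    omega
  obtain ⟨X, hX1, hX2, hmin, htr⟩ := exists_isoperimetric_atom A 1 ⟨P, hP.card_pos, hPA'⟩
  obtain ⟨x₀, hx₀⟩ := Finset.card_pos.1 hX1
  let H : AddSubgroup G :=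
    { carrier := {g | g +ᵥ X = X}
      zero_mem' := by simp
      add_mem' := by
        intro a b ha hb
        simp only [Set.mem_ofPred_eq] at *
        rw [add_vadd, hb, ha]
      neg_mem' := by
        intro a ha
        simp only [Set.mem_ofPred_eq] at *
        rw [neg_vadd_eq_iff, ha] }
  -- If all of A stabilised X, then X would be the whole group. An a that moves X moves it off
  -- itself, so |X + A| ≥ 2|X|; with |X + A| ≥ |A| the excess of X is at least |A|/2.
  have hex : ∃ a ∈ A, a +ᵥ X ≠ X := by
    by_contra! hcon
    have hle : AddSubgroup.closure (A : Set G) ≤ H := by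
      rw [AddSubgroup.closure_le]
      intro a ha
      exact hcon a ha
    rw [hA] at hle
    have hall : X = Finset.univ := by
      ext g
      simp only [Finset.mem_univ, iff_true]
      have : (g - x₀) +ᵥ X = X := hle (AddSubgroup.mem_top (g - x₀))
      rw [← this, Finset.mem_vadd_finset]
      exact ⟨x₀, hx₀, by simp⟩
    have : X.card ≤ (X + A).card := Finset.card_le_card (by
      intro x hx
      rw [Finset.mem_add]
      exact ⟨x, hx, 0, h0, by simp⟩)
    rw [hall, Finset.card_univ] at this
    rw [hall] at hX2
    omega
  obtain ⟨a, ha, haX⟩ := hex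
  have hdisj : Disjoint X (a +ᵥ X) := by
    rw [Finset.disjoint_iff_inter_eq_empty, ← Finset.card_eq_zero]
    rcases htr a with h | h
    · exact absurd h haX
    · omega
  have hsub : X ∪ (a +ᵥ X) ⊆ X + A := by
    intro x hx
    rw [Finset.mem_union] at hx
    rw [Finset.mem_add]
    rcases hx with hx | hx
    · exact ⟨x, hx, 0, h0, by simp⟩
    · rw [Finset.mem_vadd_finset] at hx
      obtain ⟨y, hy, rfl⟩ := hx
      exact ⟨y, hy, a, ha, by simp [add_comm]⟩
  have hc := Finset.card_le_card hsub
  rw [Finset.card_union_of_disjoint hdisj, Finset.card_vadd_finset] at hc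
  have hAc : A.card ≤ (X + A).card := Finset.card_le_card_add_left ⟨x₀, hx₀⟩
  have := hmin P hP.card_pos hPA'
  omega

end Isoperimetric

/-! ### Iterated sumsets, residues and normalisation of integer sets. -/

/-- The `j`-fold sumset `A + ⋯ + A`. -/
def iterSum {G : Type*} [AddCommMonoid G] [DecidableEq G] (A : Finset G) : ℕ → Finset G
  | 0 => {0}
  | j + 1 => iterSum A j + A

theorem iterSum_one {G : Type*} [AddCommMonoid G] [DecidableEq G] (A : Finset G) :
    iterSum A 1 = A := by
  change {0} + A = A
  rw [Finset.singleton_add]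
  simp

theorem iterSum_two {G : Type*} [AddCommMonoid G] [DecidableEq G] (A : Finset G) :
    iterSum A 2 = A + A := by
  change iterSum A 1 + A = A + A
  rw [iterSum_one]

theorem iterSum_mono {G : Type*} [AddCommMonoid G] [DecidableEq G] {A B : Finset G}
    (h : A ⊆ B) (j : ℕ) : iterSum A j ⊆ iterSum B j := by
  induction j with
  | zero => exact subset_rfl
  | succ j ih => exact Finset.add_subset_add ih h

theorem iterSum_nonempty {G : Type*} [AddCommMonoid G] [DecidableEq G] {A : Finset G}
    (h : A.Nonempty) (j : ℕ) : (iterSum A j).Nonempty := by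
  induction j with
  | zero => exact Finset.singleton_nonempty 0
  | succ j ih => exact ih.add h

/-- The residues modulo `l` of a finite set of integers. -/
def residues (l : ℕ) (A : Finset ℤ) : Finset (ZMod l) :=
  A.image (fun z : ℤ => (z : ZMod l))

theorem mem_residues {l : ℕ} {A : Finset ℤ} {r : ZMod l} :
    r ∈ residues l A ↔ ∃ z ∈ A, (z : ZMod l) = r := by
  simp [residues]

theorem residues_add (l : ℕ) (A B : Finset ℤ) :
    residues l (A + B) = residues l A + residues l B := by
  unfold residues
  exact Finset.image_add (Int.castAddHom (ZMod l))

theorem card_residues_of_subset_Ico {l : ℕ} {A : Finset ℤ} {u : ℤ}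
    (h : A ⊆ Finset.Ico u (u + l)) : (residues l A).card = A.card := by
  apply Finset.card_image_of_injOn
  intro x hx y hy hxy
  have h1 := Finset.mem_Ico.1 (h hx)
  have h2 := Finset.mem_Ico.1 (h hy)
  have h3 := (ZMod.intCast_eq_intCast_iff_dvd_sub x y l).1 hxy
  have : y - x = 0 := Int.eq_zero_of_abs_lt_dvd h3 (by rw [abs_lt]; constructor <;> linarith)
  linarith

theorem card_le_card_residues_add_one {l : ℕ} {A : Finset ℤ} (h : A ⊆ Finset.Icc 0 (l : ℤ)) :
    A.card ≤ (residues l A).card + 1 := by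
  have h1 : (residues l (A.erase l)).card = (A.erase l).card := by
    apply card_residues_of_subset_Ico (u := 0)
    intro x hx
    rw [Finset.mem_erase] at hx
    have := Finset.mem_Icc.1 (h hx.2)
    rw [Finset.mem_Ico]
    have h3 := hx.1
    omega
  have h2 : (residues l (A.erase l)).card ≤ (residues l A).card :=
    Finset.card_le_card (Finset.image_subset_image (Finset.erase_subset _ _))
  have h3 := Finset.pred_card_le_card_erase (s := A) (a := (l : ℤ))
  omega

/-- If `A` contains `0` and `l`, then `A + B` has an element outside `B + l` in each of its
residue classes modulo `l`. -/
theorem card_add_card_residues_le {l : ℕ} (hl : 0 < l) {A : Finset ℤ} (B : Finset ℤ)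
    (h0 : (0 : ℤ) ∈ A) (hlA : (l : ℤ) ∈ A) :
    B.card + (residues l (A + B)).card ≤ (A + B).card := by
  classical
  have hsub : (l : ℤ) +ᵥ B ⊆ A + B := by
    intro x hx
    obtain ⟨b, hb, rfl⟩ := Finset.mem_vadd_finset.1 hx
    exact Finset.add_mem_add hlA hb
  -- The least element of a class is not of the form l + b, since 0 + b would be a smaller one.
  have hres : residues l (A + B) ⊆ residues l ((A + B) \ ((l : ℤ) +ᵥ B)) := by
    intro r hr
    obtain ⟨z, hz, rfl⟩ := mem_residues.1 hr
    obtain ⟨w, hw, hmin⟩ := Finset.exists_min_image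
      ((A + B).filter (fun x : ℤ => (x : ZMod l) = (z : ZMod l))) id
      ⟨z, by simp [Finset.mem_filter, hz]⟩
    rw [Finset.mem_filter] at hw
    refine mem_residues.2 ⟨w, ?_, hw.2⟩
    rw [Finset.mem_sdiff]
    refine ⟨hw.1, fun hwB => ?_⟩
    obtain ⟨b, hb, hbw⟩ := Finset.mem_vadd_finset.1 hwB
    simp only [vadd_eq_add] at hbw
    have := hmin b (by
      rw [Finset.mem_filter]
      refine ⟨?_, ?_⟩
      · have := Finset.add_mem_add h0 hb
        rwa [zero_add] at this
      · rw [← hw.2, ← hbw]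
        simp)
    simp only [id] at this
    omega
  have h1 := Finset.card_le_card hres
  have h2 : (residues l ((A + B) \ ((l : ℤ) +ᵥ B))).card ≤ ((A + B) \ ((l : ℤ) +ᵥ B)).card :=
    Finset.card_image_le
  rw [Finset.card_sdiff_of_subset hsub, Finset.card_vadd_finset] at h2
  have h3 := Finset.card_le_card hsub
  rw [Finset.card_vadd_finset] at h3
  omega

/-- `A` is contained in `[0, l]`, contains both end points, and is not contained in a proper
subgroup modulo `l`. -/
structure IsNormalized (A : Finset ℤ) (l : ℕ) : Prop where
  pos : 0 < l
  zero_mem : (0 : ℤ) ∈ A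
  right_mem : (l : ℤ) ∈ A
  subset : A ⊆ Finset.Icc 0 (l : ℤ)
  closure : AddSubgroup.closure (residues l A : Set (ZMod l)) = ⊤

/-- Move the minimum to 0 and divide by the gcd of the differences; the new set generates ℤ, so its
residues generate ℤ/l. -/
theorem exists_isNormalized (A : Finset ℤ) (hA : 2 ≤ A.card) :
    ∃ (c d : ℤ) (l : ℕ) (A' : Finset ℤ), 0 < d ∧ IsNormalized A' l ∧
      A = A'.image (fun z => c + d * z) := by
  classical
  have hne : A.Nonempty := Finset.card_pos.1 (by omega)
  set c := A.min' hne with hc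
  set M := A.max' hne with hM
  have hcM : c < M := Finset.min'_lt_max'_of_card A (by omega)
  obtain ⟨d₀, hd₀⟩ := Int.subgroup_cyclic
    (AddSubgroup.closure ((A.image (fun x => x - c) : Finset ℤ) : Set ℤ))
  have hmem : ∀ x ∈ A, d₀ ∣ x - c := by
    intro x hx
    have : x - c ∈ AddSubgroup.closure ((A.image (fun x => x - c) : Finset ℤ) : Set ℤ) :=
      AddSubgroup.subset_closure (Finset.mem_coe.2 (Finset.mem_image.2 ⟨x, hx, rfl⟩))
    rw [hd₀, AddSubgroup.mem_closure_singleton] at this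
    obtain ⟨n, hn⟩ := this
    exact ⟨n, by rw [← hn]; simp [mul_comm]⟩
  have hd₀0 : d₀ ≠ 0 := by
    rintro rfl
    have := hmem M (A.max'_mem hne)
    rw [zero_dvd_iff] at this
    omega
  set d : ℤ := |d₀| with hd
  have hdpos : 0 < d := abs_pos.2 hd₀0
  have hmemd : ∀ x ∈ A, d ∣ x - c := fun x hx => (abs_dvd _ _).2 (hmem x hx)
  have hdcl : d ∈ AddSubgroup.closure ((A.image (fun x => x - c) : Finset ℤ) : Set ℤ) := by
    rw [hd₀, AddSubgroup.mem_closure_singleton]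
    rcases abs_choice d₀ with h | h
    · exact ⟨1, by simp [hd, h]⟩
    · exact ⟨-1, by simp [hd, h]⟩
  set A' : Finset ℤ := A.image (fun x => (x - c) / d) with hA'
  have hA'mem : ∀ x ∈ A, d * ((x - c) / d) = x - c := fun x hx => Int.mul_ediv_cancel' (hmemd x hx)
  have hone : (1 : ℤ) ∈ AddSubgroup.closure (A' : Set ℤ) := by
    have hmap : AddSubgroup.map (AddMonoidHom.mulLeft d) (AddSubgroup.closure (A' : Set ℤ)) =
        AddSubgroup.closure ((A.image (fun x => x - c) : Finset ℤ) : Set ℤ) := by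
      rw [AddMonoidHom.map_closure]
      congr 1
      ext y
      simp only [Set.mem_image, Finset.mem_coe, hA', Finset.mem_image, AddMonoidHom.coe_mulLeft]
      constructor
      · rintro ⟨_, ⟨x, hx, rfl⟩, rfl⟩
        exact ⟨x, hx, (hA'mem x hx).symm⟩
      · rintro ⟨x, hx, rfl⟩
        exact ⟨_, ⟨x, hx, rfl⟩, hA'mem x hx⟩
    rw [← hmap] at hdcl
    obtain ⟨y, hy, hyd⟩ := hdcl
    have : y = 1 := by
      have h1 : d * y = d * 1 := by simpa using hyd
      exact mul_left_cancel₀ hdpos.ne' h1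
    rwa [this] at hy
  have hl : ((M - c) / d).toNat = (M - c) / d :=
    Int.toNat_of_nonneg (Int.ediv_nonneg (by omega) hdpos.le)
  have hMd := hA'mem M (A.max'_mem hne)
  refine ⟨c, d, ((M - c) / d).toNat, A', hdpos, ⟨?_, ?_, ?_, ?_, ?_⟩, ?_⟩
  · have : 0 < (M - c) / d := by
      by_contra! h
      have : d * ((M - c) / d) ≤ 0 := mul_nonpos_of_nonneg_of_nonpos hdpos.le h
      omega
    omega
  · exact Finset.mem_image.2 ⟨c, A.min'_mem hne, by simp⟩
  · rw [hl]
    exact Finset.mem_image.2 ⟨M, A.max'_mem hne, rfl⟩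
  · intro y hy
    obtain ⟨x, hx, rfl⟩ := Finset.mem_image.1 hy
    rw [Finset.mem_Icc, hl]
    have h1 := A.min'_le x hx
    have h2 := A.le_max' x hx
    constructor
    · exact Int.ediv_nonneg (by omega) hdpos.le
    · exact Int.ediv_le_ediv hdpos (by omega)
  · rw [eq_top_iff]
    intro r _
    have h1 : AddSubgroup.closure (residues ((M - c) / d).toNat A' : Set _) =
        AddSubgroup.map (Int.castAddHom (ZMod ((M - c) / d).toNat))
          (AddSubgroup.closure (A' : Set ℤ)) := by
      rw [AddMonoidHom.map_closure]
      congr 1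
      simp [residues]
    rw [h1]
    obtain ⟨z, rfl⟩ := ZMod.intCast_surjective r
    refine ⟨z, ?_, rfl⟩
    have := AddSubgroup.zsmul_mem _ hone z
    simpa using this
  · ext y
    simp only [hA', Finset.mem_image]
    constructor
    · intro hy
      exact ⟨_, ⟨y, hy, rfl⟩, by rw [hA'mem y hy]; ring⟩
    · rintro ⟨_, ⟨x, hx, rfl⟩, rfl⟩
      rw [hA'mem x hx]
      simpa using hx

/-! ### Growth of sumsets of a normalised set. -/

section Normalized

variable {A : Finset ℤ} {l : ℕ}

theorem IsNormalized.card_residues (h : IsNormalized A l) : A.card ≤ (residues l A).card + 1 :=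
  card_le_card_residues_add_one h.subset

/-- Isoperimetry in ℤ/l; the loss of 1 is due to 0 ≡ l, and everything is doubled to avoid halves.
-/
theorem IsNormalized.residues_add_ge (h : IsNormalized A l) {P : Finset (ZMod l)}
    (hP : P.Nonempty) :
    min (2 * l) (2 * P.card + (A.card - 1)) ≤ 2 * (P + residues l A).card := by
  have : NeZero l := ⟨h.pos.ne'⟩
  have h0 : (0 : ZMod l) ∈ residues l A := mem_residues.2 ⟨0, h.zero_mem, by simp⟩
  have hc := h.card_residues
  rcases two_mul_card_add_ge_of_closure_eq_top (residues l A) P h0 h.closure hP with h1 | h1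
  · rw [h1, Finset.card_univ, ZMod.card]
    exact min_le_left _ _
  · refine (min_le_right _ _).trans ?_
    omega

theorem IsNormalized.residues_iterSum_ge (h : IsNormalized A l) (j : ℕ) :
    min (2 * l) ((j + 2) * (A.card - 1)) ≤ 2 * (residues l (iterSum A (j + 1))).card := by
  induction j with
  | zero =>
    rw [iterSum_one]
    have := h.card_residues
    refine (min_le_right _ _).trans ?_
    omega
  | succ j ih =>
    have hne : (residues l (iterSum A (j + 1))).Nonempty :=
      (iterSum_nonempty ⟨0, h.zero_mem⟩ _).image _
    have h1 := h.residues_add_ge hne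
    rw [← residues_add] at h1
    change _ ≤ 2 * (residues l (iterSum A (j + 1) + A)).card
    refine le_trans ?_ h1
    have e : (j + 1 + 2) * (A.card - 1) = (j + 2) * (A.card - 1) + (A.card - 1) := by ring
    rw [e]
    omega

/-- Each further summand gains the number of residues of the new sumset, by
`card_add_card_residues_le`. -/
theorem IsNormalized.card_iterSum_ge (h : IsNormalized A l) (j : ℕ) :
    2 * (iterSum A (j + 1)).card + min (2 * l) ((j + 3) * (A.card - 1)) ≤
      2 * (iterSum A (j + 2)).card := by
  have h1 := h.residues_iterSum_ge (j + 1)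
  have h2 := card_add_card_residues_le h.pos (iterSum A (j + 1)) h.zero_mem h.right_mem
  rw [add_comm A] at h2
  change _ + (residues l (iterSum A (j + 2))).card ≤ (iterSum A (j + 2)).card at h2
  have e : j + 1 + 2 = j + 3 := rfl
  rw [e] at h1
  change _ ≤ 2 * (residues l (iterSum A (j + 2))).card at h1
  omega

/-- A set of integers with doubling less than `5 / 2` is contained in a short progression. -/
theorem IsNormalized.add_card_le_of_card_add_self (h : IsNormalized A l)
    (hA : 2 * (A + A).card + 4 ≤ 5 * A.card) : l + A.card ≤ (A + A).card := by
  -- If the minimum were 3(|A| - 1), then 2|2A| ≥ 5|A| - 3, against the hypothesis.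
  have h1 := h.card_iterSum_ge 0
  rw [iterSum_one, iterSum_two] at h1
  omega

/-- Put a = |A| - 1. If l > 2.7a, the doubled increments from A to 6A are at least 3a, 4a, 5a, 5.4a,
5.4a, so |6A| ≥ 12.4a + 1, which is exactly what the hypothesis excludes. -/
theorem IsNormalized.length_le_of_card_iterSum_six (h : IsNormalized A l)
    (hA : 10 * (iterSum A 6).card + 114 < 124 * A.card) : 10 * l ≤ 27 * (A.card - 1) := by
  have h1 := h.card_iterSum_ge 0
  have h2 := h.card_iterSum_ge 1
  have h3 := h.card_iterSum_ge 2
  have h4 := h.card_iterSum_ge 3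
  have h5 := h.card_iterSum_ge 4
  rw [iterSum_one] at h1
  norm_num at h1 h2 h3 h4 h5
  by_contra! hcon
  omega

end Normalized

theorem card_iterSum_ge {A : Finset ℤ} (hA : A.Nonempty) (j : ℕ) :
    j * (A.card - 1) + 1 ≤ (iterSum A j).card := by
  induction j with
  | zero => simp [iterSum]
  | succ j ih =>
    have h1 := cauchy_davenport_add_of_linearOrder_isCancelAdd (iterSum_nonempty hA j) hA
    change _ ≤ (iterSum A j + A).card
    have := hA.card_pos
    have e : (j + 1) * (A.card - 1) = j * (A.card - 1) + (A.card - 1) := by ring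
    rw [e]
    omega

/-- If `A + B` contains `l` consecutive integers, where `A ⊆ [0, l]` and `B` spans `[0, s]`, and is
small, then `A + B` has an element outside `A + s` in each residue class modulo `s`. -/
theorem length_add_card_le_of_Ico_subset {A B : Finset ℤ} {l s : ℕ} {u : ℤ} (hs : 0 < s)
    (hA : A ⊆ Finset.Icc 0 (l : ℤ)) (hAne : A.Nonempty) (hB : B ⊆ Finset.Icc 0 (s : ℤ))
    (h0 : (0 : ℤ) ∈ B) (hsB : (s : ℤ) ∈ B) (hu : Finset.Ico u (u + l) ⊆ A + B)
    (hsmall : (A + B).card + 2 < B.card + 2 * A.card) :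
    s + A.card ≤ (A + B).card := by
  classical
  have : NeZero s := ⟨hs.ne'⟩
  have h1 := card_add_card_residues_le hs A h0 hsB
  rw [add_comm B A] at h1
  have h2 := card_le_card_residues_add_one hB
  -- Representatives of the missed residues. They lie beyond the covered interval [u, u + l), so D -
  -- A fits into the single period [u, u + s) and keeps its size modulo s.
  set D : Finset ℤ := (Finset.Ico (u + l) (u + s)).filter
    (fun x : ℤ => (x : ZMod s) ∉ residues s (A + B)) with hD
  have hcompl : (residues s (A + B))ᶜ ⊆ residues s D := by
    intro r hr
    rw [Finset.mem_compl] at hr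
    obtain ⟨z, rfl⟩ := ZMod.intCast_surjective r
    have hs' : (0 : ℤ) < s := by exact_mod_cast hs
    have hcast : ((u + (z - u) % s : ℤ) : ZMod s) = (z : ZMod s) := by
      rw [ZMod.intCast_eq_intCast_iff_dvd_sub]
      have := Int.dvd_self_sub_emod (x := z - u) (m := s)
      convert this using 1
      ring
    have hm1 := Int.emod_nonneg (z - u) hs'.ne'
    have hm2 := Int.emod_lt_of_pos (z - u) hs'
    refine mem_residues.2 ⟨u + (z - u) % s, ?_, hcast⟩
    rw [hD, Finset.mem_filter, Finset.mem_Ico, hcast]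
    refine ⟨⟨?_, by omega⟩, hr⟩
    by_contra! hlt
    apply hr
    rw [← hcast]
    exact mem_residues.2 ⟨_, hu (Finset.mem_Ico.2 ⟨by omega, hlt⟩), rfl⟩
  have h3 := Finset.card_le_card hcompl
  rw [Finset.card_compl, ZMod.card] at h3
  have h4 : (residues s D).card ≤ D.card := Finset.card_image_le
  have h34 := h3.trans h4
  have h5 : (residues s (A + B)).card ≤ s := by
    have := Finset.card_le_univ (residues s (A + B))
    rwa [ZMod.card] at this
  rcases D.eq_empty_or_nonempty with hD0 | hDne
  · rw [hD0, Finset.card_empty] at h34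
    omega
  · have h6 := cauchy_davenport_add_of_linearOrder_isCancelAdd hDne hAne.neg
    rw [Finset.card_neg] at h6
    have h7 : (residues s (D + -A)).card = (D + -A).card := by
      apply card_residues_of_subset_Ico (u := u)
      intro x hx
      obtain ⟨y, hy, z, hz, rfl⟩ := Finset.mem_add.1 hx
      rw [Finset.mem_neg'] at hz
      have e1 := Finset.mem_Icc.1 (hA hz)
      rw [hD, Finset.mem_filter, Finset.mem_Ico] at hy
      rw [Finset.mem_Ico]
      omega
    -- A missed residue is never a + b. Hence |D| + |A| + |B| - 2 ≤ s, which contradicts smallness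
    -- since |D| ≥ s + |A| - |A + B|.
    have hdisj : Disjoint (residues s (D + -A)) (residues s B) := by
      rw [Finset.disjoint_left]
      intro r hr hrB
      obtain ⟨x, hx, rfl⟩ := mem_residues.1 hr
      obtain ⟨b, hb, hbx⟩ := mem_residues.1 hrB
      obtain ⟨y, hy, z, hz, rfl⟩ := Finset.mem_add.1 hx
      rw [Finset.mem_neg'] at hz
      rw [hD, Finset.mem_filter] at hy
      apply hy.2
      refine mem_residues.2 ⟨-z + b, Finset.add_mem_add hz hb, ?_⟩
      push_cast at hbx ⊢
      rw [hbx]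
      ring
    have h8 := Finset.card_le_univ (residues s (D + -A) ∪ residues s B)
    rw [Finset.card_union_of_disjoint hdisj, ZMod.card] at h8
    have := hDne.card_pos
    omega

theorem add_eq_univ_of_card_lt {G : Type*} [AddCommGroup G] [Fintype G] [DecidableEq G]
    (P Q : Finset G) (h : Fintype.card G < P.card + Q.card) : P + Q = Finset.univ := by
  classical
  ext g
  simp only [Finset.mem_univ, iff_true]
  by_contra hg
  have hdisj : Disjoint P (Q.image (fun q => g - q)) := by
    rw [Finset.disjoint_left]
    intro x hx hx'
    obtain ⟨q, hq, rfl⟩ := Finset.mem_image.1 hx'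
    exact hg (Finset.mem_add.2 ⟨_, hx, q, hq, by abel⟩)
  have h1 := Finset.card_le_univ (P ∪ Q.image (fun q => g - q))
  rw [Finset.card_union_of_disjoint hdisj,
    Finset.card_image_of_injective _ sub_right_injective] at h1
  omega

/-! ### Windows: points outside B ∪ D forced by spreading residues. -/

section Window

variable {A : Finset ℤ} {l : ℕ}

/-- If `B` meets the beginning of an interval and `D`, a set disjoint from `B + A`, meets its end,
then the residues modulo `l` of `B` spread inside the interval, up to the set `G` of the elements
outside `B ∪ D`. -/
theorem IsNormalized.exists_residue_chain (hA : IsNormalized A l) {B D : Set ℤ}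
    (hBD : ∀ b ∈ B, ∀ a ∈ A, b + a ∉ D) {u : ℤ} {J : ℕ}
    (hb : ∃ b ∈ B, u ≤ b ∧ b < u + l)
    (hd : ∃ d ∈ D, u + (J + 1) * l ≤ d ∧ d < u + (J + 2) * l) (G : Finset ℤ)
    (hG : ∀ x, u ≤ x → x < u + (J + 2) * l → x ∉ B → x ∉ D → x ∈ G) :
    ∃ P : ℕ → Finset (ZMod l), (P 1).Nonempty ∧
      (∀ j, 1 ≤ j → j ≤ J → (P j + residues l A).card ≤ (P (j + 1)).card + G.card) ∧
      (P J).card + (residues l A).card ≤ l + G.card := by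
  classical
  have : NeZero l := ⟨hA.pos.ne'⟩
  have hl : (0 : ℤ) < l := by exact_mod_cast hA.pos
  have hGc : (residues l G).card ≤ G.card := Finset.card_image_le
  -- Adding A moves B ∩ [u, u + jl) by at most l and avoids D, so the result lies in B ∩ [u, u + (j
  -- + 1)l) or in G.
  let Q : ℕ → Finset ℤ := fun j => (Finset.Ico u (u + j * l)).filter (fun x => x ∈ B)
  have memQ : ∀ j x, x ∈ Q j ↔ (u ≤ x ∧ x < u + j * l) ∧ x ∈ B := by
    intro j x
    simp only [Q, Finset.mem_filter, Finset.mem_Ico]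
  refine ⟨fun j => residues l (Q j), ?_, ?_, ?_⟩
  · obtain ⟨b, hbB, h1, h2⟩ := hb
    refine Finset.Nonempty.image ⟨b, (memQ _ _).2 ⟨⟨h1, ?_⟩, hbB⟩⟩ _
    simpa using h2
  · intro j _ hjJ
    have hsub : residues l (Q j) + residues l A ⊆ residues l (Q (j + 1)) ∪ residues l G := by
      rw [← residues_add]
      intro r hr
      obtain ⟨z, hz, rfl⟩ := mem_residues.1 hr
      obtain ⟨b, hb', a, ha, rfl⟩ := Finset.mem_add.1 hz
      have h1 := (memQ _ _).1 hb'
      have h2 := Finset.mem_Icc.1 (hA.subset ha)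
      have h3 := hBD b h1.2 a ha
      have h4 : b + a < u + (j + 1 : ℕ) * l := by
        push_cast
        linarith [h1.1.2, h2.2]
      have h5 : u + ((j + 1 : ℕ) : ℤ) * l ≤ u + (J + 2) * l := by
        have : ((j + 1 : ℕ) : ℤ) ≤ J + 2 := by push_cast; omega
        nlinarith
      rw [Finset.mem_union]
      by_cases hB : b + a ∈ B
      · exact Or.inl (mem_residues.2 ⟨_, (memQ _ _).2 ⟨⟨by linarith [h1.1.1, h2.1], h4⟩, hB⟩, rfl⟩)
      · exact Or.inr (mem_residues.2
          ⟨_, hG _ (by linarith [h1.1.1, h2.1]) (by linarith) hB h3, rfl⟩)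
    have h1 := Finset.card_le_card hsub
    have h2 := Finset.card_union_le (residues l (Q (j + 1))) (residues l G)
    simp only
    omega
  · obtain ⟨d, hdD, hd1, hd2⟩ := hd
    -- Since l ∈ A, the sequence b, b + l, b + 2l, … cannot pass from B into D; if it avoids G
    -- modulo l it stays in B to the end of the window.
    have htail : ∀ b ∈ B, u ≤ b → (b : ZMod l) ∉ residues l G →
        ∀ i : ℕ, b + i * l < u + (J + 2) * l → b + i * l ∈ B := by
      intro b hbB hub hbG i
      induction i with
      | zero => intro _; simpa using hbB
      | succ i ih =>
        intro hi
        push_cast at hi ⊢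
        have h1 := ih (by nlinarith)
        have h2 := hBD _ h1 l hA.right_mem
        have e : b + (i : ℤ) * l + l = b + ((i : ℤ) + 1) * l := by ring
        rw [e] at h2
        by_contra hcon
        have hx := hG _ (by nlinarith [Int.natCast_nonneg i]) hi hcon h2
        apply hbG
        exact mem_residues.2 ⟨_, hx, by push_cast; simp⟩
    -- Otherwise such a sequence reaches d - a, and d ∈ B + A. That d lies in the last block makes d
    -- - a come after b.
    have hdisj : Disjoint (residues l (Q J) \ residues l G)
        ((residues l A).image (fun r => (d : ZMod l) - r)) := by
      rw [Finset.disjoint_left]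
      intro r hr hr'
      rw [Finset.mem_sdiff] at hr
      obtain ⟨b, hb', rfl⟩ := mem_residues.1 hr.1
      obtain ⟨r', hr1, hr2⟩ := Finset.mem_image.1 hr'
      obtain ⟨a, ha, rfl⟩ := mem_residues.1 hr1
      have h1 := (memQ _ _).1 hb'
      have h2 := Finset.mem_Icc.1 (hA.subset ha)
      have hdvd : (l : ℤ) ∣ d - a - b := by
        rw [← ZMod.intCast_eq_intCast_iff_dvd_sub]
        push_cast
        exact hr2.symm
      obtain ⟨i, hi⟩ := hdvd
      have hi0 : 0 ≤ i := by
        have : 0 < (l : ℤ) * i := by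
          rw [← hi]
          have := h1.1.2
          nlinarith
        nlinarith
      obtain ⟨i', rfl⟩ := Int.eq_ofNat_of_zero_le hi0
      have h3 := htail b h1.2 h1.1.1 hr.2 i' (by nlinarith)
      have h4 := hBD _ h3 a ha
      apply h4
      have e : b + (i' : ℤ) * l + a = d := by linarith
      rwa [e]
    have h1 := Finset.card_le_univ ((residues l (Q J) \ residues l G) ∪
      ((residues l A).image (fun r => (d : ZMod l) - r)))
    rw [Finset.card_union_of_disjoint hdisj, ZMod.card,
      Finset.card_image_of_injective _ sub_right_injective] at h1
    have h2 := Finset.le_card_sdiff (residues l G) (residues l (Q J))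
    simp only
    omega

/-- The property that every interval of length `(J + 2) l` at whose beginning there is an element
of `B` and at whose end there is an element of a set `D` disjoint from `B + A` has at least `γ`
elements outside `B ∪ D`. -/
def HasWindowGain (A : Finset ℤ) (l J γ : ℕ) : Prop :=
  ∀ B D : Set ℤ, (∀ b ∈ B, ∀ a ∈ A, b + a ∉ D) → ∀ u : ℤ,
    (∃ b ∈ B, u ≤ b ∧ b < u + l) →
    (∃ d ∈ D, u + (J + 1) * l ≤ d ∧ d < u + (J + 2) * l) → ∀ G : Finset ℤ,
    (∀ x, u ≤ x → x < u + (J + 2) * l → x ∉ B → x ∉ D → x ∈ G) → γ ≤ G.card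

/-- If |G| < γ, then |P 2| + |A mod l| > l, so P 2 + A is everything and P 3 misses at most |G|
residues. The condition at the end of the chain then forces |A| - 1 ≤ 2|G|, which is too much. -/
theorem IsNormalized.hasWindowGain_of_dense (hA : IsNormalized A l) {γ : ℕ}
    (h1 : 2 * γ < A.card + 1) (h2 : l + γ + 1 < 2 * A.card) : HasWindowGain A l 3 γ := by
  intro B D hBD u hb hd G hG
  have : NeZero l := ⟨hA.pos.ne'⟩
  obtain ⟨P, hP1, hP, hPJ⟩ := hA.exists_residue_chain (J := 3) hBD hb hd G hG
  have hq := hA.card_residues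
  have c1 := hP 1 le_rfl (by norm_num)
  have c2 := hP 2 (by norm_num) (by norm_num)
  have c0 : (residues l A).card ≤ (P 1 + residues l A).card := Finset.card_le_card_add_left hP1
  norm_num at c1 c2
  by_contra! hcon
  have := add_eq_univ_of_card_lt (P 2) (residues l A) (by rw [ZMod.card]; omega)
  rw [this, Finset.card_univ, ZMod.card] at c2
  omega

/-- Put a = |A| - 1 and suppose |G| < 0.13a. Then |P 2| ≥ 0.87a, and each step gains at least 0.37a
unless all but |G| residues are reached. So |P 7| ≥ min(l - |G|, 2.72a), while the end condition
gives |P 7| ≤ l + |G| - a with l ≤ 2.7a; both alternatives fail. -/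
theorem IsNormalized.hasWindowGain_of_sparse (hA : IsNormalized A l) {γ : ℕ}
    (h1 : 10 * l ≤ 27 * (A.card - 1)) (h2 : 100 * γ ≤ 13 * (A.card - 1) + 99) :
    HasWindowGain A l 7 γ := by
  intro B D hBD u hb hd G hG
  obtain ⟨P, hP1, hP, hPJ⟩ := hA.exists_residue_chain (J := 7) hBD hb hd G hG
  have hq := hA.card_residues
  have hl := hA.pos
  have c0 : (residues l A).card ≤ (P 1 + residues l A).card := Finset.card_le_card_add_left hP1
  by_contra! hcon
  have hγ : 100 * G.card < 13 * (A.card - 1) := by omega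
  have c1 := hP 1 le_rfl (by norm_num)
  norm_num at c1
  have step : ∀ j, 1 ≤ j → j ≤ 7 → (P j).Nonempty →
      min (2 * l) (2 * (P j).card + (A.card - 1)) ≤ 2 * (P (j + 1)).card + 2 * G.card := by
    intro j h1 h2 h3
    have := hA.residues_add_ge h3
    have := hP j h1 h2
    omega
  have n2 : (P 2).Nonempty := Finset.card_pos.1 (by omega)
  have c2 := step 2 (by norm_num) (by norm_num) n2
  norm_num at c2
  have n3 : (P 3).Nonempty := Finset.card_pos.1 (by omega)
  have c3 := step 3 (by norm_num) (by norm_num) n3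
  norm_num at c3
  have n4 : (P 4).Nonempty := Finset.card_pos.1 (by omega)
  have c4 := step 4 (by norm_num) (by norm_num) n4
  norm_num at c4
  have n5 : (P 5).Nonempty := Finset.card_pos.1 (by omega)
  have c5 := step 5 (by norm_num) (by norm_num) n5
  norm_num at c5
  have n6 : (P 6).Nonempty := Finset.card_pos.1 (by omega)
  have c6 := step 6 (by norm_num) (by norm_num) n6
  norm_num at c6
  omega

end Window

/-! ### From windows on the circle to an interval containing B. -/

section Cyclic

variable {p : ℕ}

/-- The representatives in `[v, v + p)` of the elements of `B`. -/
noncomputable def liftFrom (v : ℤ) (B : Finset (ZMod p)) : Finset ℤ :=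
  (Finset.Ico v (v + p)).filter (fun x : ℤ => (x : ZMod p) ∈ B)

theorem mem_liftFrom {v : ℤ} {B : Finset (ZMod p)} {x : ℤ} :
    x ∈ liftFrom v B ↔ (v ≤ x ∧ x < v + p) ∧ (x : ZMod p) ∈ B := by
  simp [liftFrom]

variable [NeZero p]

theorem exists_intCast_eq_mem_Ico (v : ℤ) (r : ZMod p) :
    ∃ x : ℤ, v ≤ x ∧ x < v + p ∧ (x : ZMod p) = r := by
  obtain ⟨z, rfl⟩ := ZMod.intCast_surjective r
  have hp : (0 : ℤ) < p := by exact_mod_cast NeZero.pos p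
  refine ⟨v + (z - v) % p, ?_, ?_, ?_⟩
  · linarith [Int.emod_nonneg (z - v) hp.ne']
  · linarith [Int.emod_lt_of_pos (z - v) hp]
  · rw [ZMod.intCast_eq_intCast_iff_dvd_sub]
    have := Int.dvd_self_sub_emod (x := z - v) (m := p)
    convert this using 1
    ring

theorem residues_liftFrom (v : ℤ) (B : Finset (ZMod p)) : residues p (liftFrom v B) = B := by
  ext r
  rw [mem_residues]
  constructor
  · rintro ⟨x, hx, rfl⟩
    exact (mem_liftFrom.1 hx).2
  · intro hr
    obtain ⟨x, h1, h2, rfl⟩ := exists_intCast_eq_mem_Ico v r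
    exact ⟨x, mem_liftFrom.2 ⟨⟨h1, h2⟩, hr⟩, rfl⟩

theorem card_liftFrom (v : ℤ) (B : Finset (ZMod p)) : (liftFrom v B).card = B.card := by
  have h : liftFrom v B ⊆ Finset.Ico v (v + p) := Finset.filter_subset _ _
  rw [← card_residues_of_subset_Ico h, residues_liftFrom]

variable {A : Finset ℤ} {l : ℕ}

/-- Disjoint windows contribute their gains independently. -/
theorem HasWindowGain.mul_le {J γ : ℕ} (hw : HasWindowGain A l J γ) (hA : IsNormalized A l) {B D : Finset (ZMod p)}
    (hBD : ∀ b ∈ B, ∀ a ∈ A, b + (a : ZMod p) ∉ D) (v : ℤ) (M : ℕ) (hM : M * ((J + 2) * l) ≤ p)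
    (hb : ∀ i < M, ∃ b : ℤ, (b : ZMod p) ∈ B ∧ v + i * ((J + 2) * l) ≤ b ∧
      b < v + i * ((J + 2) * l) + l)
    (hd : ∀ i < M, ∃ d : ℤ, (d : ZMod p) ∈ D ∧ v + i * ((J + 2) * l) + (J + 1) * l ≤ d ∧
      d < v + i * ((J + 2) * l) + (J + 2) * l) :
    M * γ + B.card + D.card ≤ p := by
  classical
  have key : ∀ N ≤ M, N * γ ≤ ((Finset.Ico v (v + N * ((J + 2) * l))).filter
      (fun x : ℤ => (x : ZMod p) ∉ B ∧ (x : ZMod p) ∉ D)).card := by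
    intro N
    induction N with
    | zero => intro _; simp
    | succ N ih =>
      intro hN
      have h1 := ih (by omega)
      set w : ℤ := (J + 2) * l with hwdef
      have hw0 : 0 ≤ w := by positivity
      have h2 := hw {x | (x : ZMod p) ∈ B} {x | (x : ZMod p) ∈ D}
        (by
          intro b hb a ha hD
          have : ((b + a : ℤ) : ZMod p) ∈ D := hD
          push_cast at this
          exact hBD _ hb a ha this) (v + N * w)
        (by
          obtain ⟨b, h1, h2, h3⟩ := hb N (by omega)
          exact ⟨b, h1, h2, h3⟩)
        (by
          obtain ⟨d, h1, h2, h3⟩ := hd N (by omega)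
          exact ⟨d, h1, h2, h3⟩)
        ((Finset.Ico (v + N * w) (v + (N + 1 : ℕ) * w)).filter
          (fun x : ℤ => (x : ZMod p) ∉ B ∧ (x : ZMod p) ∉ D))
        (by
          intro x h1 h2 h3 h4
          rw [Finset.mem_filter, Finset.mem_Ico]
          refine ⟨⟨h1, ?_⟩, h3, h4⟩
          push_cast
          linarith)
      have hdisj : Disjoint ((Finset.Ico v (v + N * w)).filter
          (fun x : ℤ => (x : ZMod p) ∉ B ∧ (x : ZMod p) ∉ D))
          ((Finset.Ico (v + N * w) (v + (N + 1 : ℕ) * w)).filter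
          (fun x : ℤ => (x : ZMod p) ∉ B ∧ (x : ZMod p) ∉ D)) := by
        apply Finset.disjoint_filter_filter
        exact Finset.Ico_disjoint_Ico_consecutive _ _ _
      have hun : ((Finset.Ico v (v + N * w)).filter
          (fun x : ℤ => (x : ZMod p) ∉ B ∧ (x : ZMod p) ∉ D)) ∪
          ((Finset.Ico (v + N * w) (v + (N + 1 : ℕ) * w)).filter
          (fun x : ℤ => (x : ZMod p) ∉ B ∧ (x : ZMod p) ∉ D)) ⊆
          (Finset.Ico v (v + (N + 1 : ℕ) * w)).filter
          (fun x : ℤ => (x : ZMod p) ∉ B ∧ (x : ZMod p) ∉ D) := by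
        rw [← Finset.filter_union]
        apply Finset.filter_subset_filter
        rw [Finset.Ico_union_Ico_eq_Ico]
        · nlinarith [Int.natCast_nonneg N]
        · push_cast
          nlinarith
      have h3 := Finset.card_le_card hun
      rw [Finset.card_union_of_disjoint hdisj] at h3
      rw [Nat.succ_mul]
      omega
  have h1 := key M le_rfl
  have hdisj : Disjoint B D := by
    rw [Finset.disjoint_left]
    intro x hx hxD
    have := hBD x hx 0 hA.zero_mem
    simp at this
    exact this hxD
  have hle : (((M : ℤ) * ((J + 2) * l) : ℤ)) ≤ p := by exact_mod_cast hM
  have h2 : (residues p ((Finset.Ico v (v + M * ((J + 2) * l))).filter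
      (fun x : ℤ => (x : ZMod p) ∉ B ∧ (x : ZMod p) ∉ D))).card =
      ((Finset.Ico v (v + M * ((J + 2) * l))).filter
      (fun x : ℤ => (x : ZMod p) ∉ B ∧ (x : ZMod p) ∉ D)).card := by
    apply card_residues_of_subset_Ico (u := v)
    refine (Finset.filter_subset _ _).trans ?_
    apply Finset.Ico_subset_Ico le_rfl
    linarith
  have h3 : residues p ((Finset.Ico v (v + M * ((J + 2) * l))).filter
      (fun x : ℤ => (x : ZMod p) ∉ B ∧ (x : ZMod p) ∉ D)) ⊆ (B ∪ D)ᶜ := by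
    intro r hr
    obtain ⟨x, hx, rfl⟩ := mem_residues.1 hr
    rw [Finset.mem_filter] at hx
    rw [Finset.mem_compl, Finset.mem_union]
    tauto
  have h4 := Finset.card_le_card h3
  have h5 := Finset.card_le_univ (B ∪ D)
  rw [Finset.card_compl, ZMod.card, Finset.card_union_of_disjoint hdisj] at h4
  rw [ZMod.card, Finset.card_union_of_disjoint hdisj] at h5
  omega

/-- If `B` misses an interval of length `l`, then `B` spans an interval of length `s < p - l`,
inside which the set `D` disjoint from `B + A` misses an interval of length `l`. -/
theorem exists_span_of_gap {J γ M g : ℕ} (hA : IsNormalized A l) (hw : HasWindowGain A l J γ)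
    {B D : Finset (ZMod p)} (hBD : ∀ b ∈ B, ∀ a ∈ A, b + (a : ZMod p) ∉ D)
    (hg : p ≤ B.card + D.card + g) (hMg : g < M * γ) (hgA : g + 2 < 2 * A.card)
    (hB : M * ((J + 2) * l) + 1 ≤ B.card)
    (hgap : ∃ c : ℤ, ∀ x : ℤ, c ≤ x → x < c + l → (x : ZMod p) ∉ B) :
    ∃ (b₀ : ℤ) (s : ℕ), s + l < p ∧ (b₀ : ZMod p) ∈ B ∧ ((b₀ + s : ℤ) : ZMod p) ∈ B ∧
      (∀ b ∈ B, ∃ i : ℕ, i ≤ s ∧ b = b₀ + (i : ZMod p)) ∧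
      ∃ u : ℤ, b₀ ≤ u ∧ u + l ≤ b₀ + s + 1 ∧ ∀ x : ℤ, u ≤ x → x < u + l → (x : ZMod p) ∉ D := by
  classical
  obtain ⟨c, hc⟩ := hgap
  have hl := hA.pos
  set B' := liftFrom (c + l) B with hB'
  have hB'c : B'.card = B.card := card_liftFrom _ _
  have hne : B'.Nonempty := Finset.card_pos.1 (by omega)
  have hB'mem : ∀ x ∈ B', c + l ≤ x ∧ x < c + p ∧ (x : ZMod p) ∈ B := by
    intro x hx
    obtain ⟨⟨h1, h2⟩, h3⟩ := mem_liftFrom.1 hx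
    refine ⟨h1, ?_, h3⟩
    by_contra! h4
    refine hc (x - p) (by linarith) (by linarith) ?_
    push_cast
    simpa using h3
  set b₀ := B'.min' hne with hb₀
  set b₁ := B'.max' hne with hb₁
  have h0 := hB'mem _ (B'.min'_mem hne)
  have h1 := hB'mem _ (B'.max'_mem hne)
  rw [← hb₀] at h0
  rw [← hb₁] at h1
  have h01 : b₀ ≤ b₁ := B'.min'_le _ (B'.max'_mem hne)
  obtain ⟨s, hs⟩ := Int.eq_ofNat_of_zero_le (sub_nonneg.2 h01)
  have hsB : B.card ≤ s + 1 := by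
    have h2 : B' ⊆ Finset.Icc b₀ b₁ := by
      intro x hx
      exact Finset.mem_Icc.2 ⟨B'.min'_le _ hx, B'.le_max' _ hx⟩
    have h3 := Finset.card_le_card h2
    rw [Int.card_Icc] at h3
    omega
  -- A second gap would split B into two parts whose sums with A are disjoint; each part gains |A| -
  -- 1 in ℤ, and 2(|A| - 1) > g.
  have hmeet : ∀ u : ℤ, b₀ ≤ u → u + l ≤ b₁ + 1 →
      ∃ b : ℤ, (b : ZMod p) ∈ B ∧ u ≤ b ∧ b < u + l := by
    intro u hu1 hu2
    by_contra! hcon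
    have hout : ∀ x ∈ B', x < u ∨ u + l ≤ x := by
      intro x hx
      by_contra! h
      have := hcon x (hB'mem x hx).2.2 h.1
      omega
    have hu3 : b₀ < u := by
      have := hout b₀ (B'.min'_mem hne)
      omega
    have hu4 : u + l ≤ b₁ := by
      have := hout b₁ (B'.max'_mem hne)
      omega
    set B₁ := B'.filter (fun x => x < u) with hB₁
    set B₂ := B'.filter (fun x => ¬ x < u) with hB₂
    have hcc : B₁.card + B₂.card = B'.card := Finset.card_filter_add_card_filter_not _
    have n1 : B₁.Nonempty := ⟨b₀, Finset.mem_filter.2 ⟨B'.min'_mem hne, hu3⟩⟩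
    have n2 : B₂.Nonempty := ⟨b₁, Finset.mem_filter.2 ⟨B'.max'_mem hne, by omega⟩⟩
    have nA : A.Nonempty := ⟨0, hA.zero_mem⟩
    have d1 : B₁.card + A.card - 1 ≤ (B₁ + A).card := by
      convert cauchy_davenport_add_of_linearOrder_isCancelAdd n1 nA
    have d2 : B₂.card + A.card - 1 ≤ (B₂ + A).card := by
      convert cauchy_davenport_add_of_linearOrder_isCancelAdd n2 nA
    have s1 : B₁ + A ⊆ Finset.Ico b₀ (u + l) := by
      intro x hx
      obtain ⟨b, hb, a, ha, rfl⟩ := Finset.mem_add.1 hx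
      have e1 := Finset.mem_filter.1 hb
      have e2 := Finset.mem_Icc.1 (hA.subset ha)
      have e3 := B'.min'_le _ e1.1
      rw [Finset.mem_Ico]
      omega
    have s2 : B₂ + A ⊆ Finset.Ico (u + l) (b₀ + p) := by
      intro x hx
      obtain ⟨b, hb, a, ha, rfl⟩ := Finset.mem_add.1 hx
      have e1 := Finset.mem_filter.1 hb
      have e2 := Finset.mem_Icc.1 (hA.subset ha)
      have e3 := hout b e1.1
      have e4 := B'.le_max' _ e1.1
      rw [Finset.mem_Ico]
      omega
    have hdisj : Disjoint (B₁ + A) (B₂ + A) :=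
      (Finset.Ico_disjoint_Ico_consecutive b₀ (u + l) (b₀ + p)).mono s1 s2
    have hun : (B₁ + A) ∪ (B₂ + A) ⊆ Finset.Ico b₀ (b₀ + p) := by
      apply Finset.union_subset
      · exact s1.trans (Finset.Ico_subset_Ico le_rfl (by omega))
      · exact s2.trans (Finset.Ico_subset_Ico (by omega) le_rfl)
    have c1 := card_residues_of_subset_Ico hun
    have c2 : residues p ((B₁ + A) ∪ (B₂ + A)) ⊆ Dᶜ := by
      intro r hr
      obtain ⟨x, hx, rfl⟩ := mem_residues.1 hr
      rw [← Finset.union_add] at hx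
      obtain ⟨b, hb, a, ha, rfl⟩ := Finset.mem_add.1 hx
      have hb' : b ∈ B' := by
        rcases Finset.mem_union.1 hb with h | h
        · exact (Finset.mem_filter.1 h).1
        · exact (Finset.mem_filter.1 h).1
      rw [Finset.mem_compl]
      push_cast
      exact hBD _ (hB'mem b hb').2.2 a ha
    have c3 := Finset.card_le_card c2
    rw [c1, Finset.card_compl, ZMod.card, Finset.card_union_of_disjoint hdisj] at c3
    have := n1.card_pos
    have := n2.card_pos
    have := nA.card_pos
    omega
  refine ⟨b₀, s, by omega, h0.2.2, ?_, ?_, ?_⟩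
  · have e : b₀ + (s : ℤ) = b₁ := by
      have : (Int.ofNat s : ℤ) = s := rfl
      omega
    rw [e]
    exact h1.2.2
  · intro b hb
    rw [← residues_liftFrom (c + l) B] at hb
    obtain ⟨x, hx, rfl⟩ := mem_residues.1 hb
    have e1 := B'.min'_le _ hx
    have e2 := B'.le_max' _ hx
    obtain ⟨i, hi⟩ := Int.eq_ofNat_of_zero_le (sub_nonneg.2 e1)
    refine ⟨i, ?_, ?_⟩
    · have : (Int.ofNat s : ℤ) = s := rfl
      have : (Int.ofNat i : ℤ) = i := rfl
      omega
    · have : x = b₀ + (i : ℤ) := by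
        rw [hb₀]
        have : (Int.ofNat i : ℤ) = i := rfl
        omega
      rw [this]
      push_cast
      rfl
  -- Otherwise M consecutive windows starting at b₀ all begin in B and end in D, and Mγ > g.
  · by_contra! hcon
    have hsM : M * ((J + 2) * l) ≤ s := by omega
    have hsM' : ((M : ℤ) * ((J + 2) * l)) ≤ s := by exact_mod_cast hsM
    have hs' : b₁ = b₀ + s := by
      have : (Int.ofNat s : ℤ) = s := rfl
      omega
    have hpos : ∀ i < M, 0 ≤ (i : ℤ) * ((J + 2) * l) ∧
        (i : ℤ) * ((J + 2) * l) + (J + 2) * l ≤ s := by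
      intro i hi
      refine ⟨by positivity, le_trans ?_ hsM'⟩
      have : (i : ℤ) + 1 ≤ M := by exact_mod_cast hi
      have h2 : (0 : ℤ) ≤ (J + 2) * l := by positivity
      nlinarith
    have hJl : (0 : ℤ) ≤ J * l := by positivity
    have := hw.mul_le hA hBD b₀ M (by omega)
      (by
        intro i hi
        have := hpos i hi
        exact hmeet _ (by linarith) (by linarith))
      (by
        intro i hi
        have := hpos i hi
        obtain ⟨x, e1, e2, e3⟩ := hcon (b₀ + i * ((J + 2) * l) + (J + 1) * l)
          (by linarith) (by linarith)
        exact ⟨x, e3, e1, by linarith⟩)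
    omega

/-- A set `B` of residues whose sum with the short integer set `A` is small is contained in a short
interval. -/
theorem exists_interval_of_hasWindowGain {J γ M g : ℕ} (hA : IsNormalized A l)
    (hw : HasWindowGain A l J γ) {B : Finset (ZMod p)}
    (hg : (residues p A + B).card ≤ B.card + g) (hMg : g < M * γ) (hgA : g + 2 < 2 * A.card)
    (hB : M * ((J + 2) * l) + 1 ≤ B.card)
    (hD : (residues p A + B).card + M * ((J + 2) * l) + 1 ≤ p) :
    ∃ (b₀ : ZMod p) (s : ℕ), s + A.card ≤ (residues p A + B).card ∧
      ∀ b ∈ B, ∃ i : ℕ, i ≤ s ∧ b = b₀ + (i : ZMod p) := by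
  classical
  have hl := hA.pos
  set D : Finset (ZMod p) := (residues p A + B)ᶜ with hDdef
  have hDc : D.card = p - (residues p A + B).card := by
    rw [hDdef, Finset.card_compl, ZMod.card]
  have hBD : ∀ b ∈ B, ∀ a ∈ A, b + (a : ZMod p) ∉ D := by
    intro b hb a ha h
    rw [hDdef, Finset.mem_compl] at h
    apply h
    rw [add_comm b]
    exact Finset.add_mem_add (mem_residues.2 ⟨a, ha, rfl⟩) hb
  -- If neither B nor D had a gap, M windows could be placed anywhere. If only D has one, the pair
  -- (-D, -B) satisfies the same hypotheses and yields a gap of -B.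
  have hgap : ∃ c : ℤ, ∀ x : ℤ, c ≤ x → x < c + l → (x : ZMod p) ∉ B := by
    by_contra! hcon
    have hDgap : ∃ c : ℤ, ∀ x : ℤ, c ≤ x → x < c + l → (x : ZMod p) ∉ D := by
      by_contra! hcon2
      have := hw.mul_le hA hBD 0 M (by omega)
        (by
          intro i _
          obtain ⟨b, e1, e2, e3⟩ := hcon (0 + i * ((J + 2) * l))
          exact ⟨b, e3, e1, e2⟩)
        (by
          intro i _
          obtain ⟨b, e1, e2, e3⟩ := hcon2 (0 + i * ((J + 2) * l) + (J + 1) * l)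
          exact ⟨b, e3, e1, by linarith⟩)
      omega
    obtain ⟨c, hc⟩ := hDgap
    obtain ⟨-, -, -, -, -, -, u, -, -, hu⟩ := exists_span_of_gap (B := -D) (D := -B) (g := g) hA hw
      (by
        intro b hb a ha h
        rw [Finset.mem_neg'] at hb h
        refine hBD _ h a ha ?_
        convert hb using 1
        ring)
      (by rw [Finset.card_neg, Finset.card_neg]; omega) hMg hgA
      (by rw [Finset.card_neg]; omega)
      ⟨-(c + l) + 1, by
        intro x h1 h2 h3
        rw [Finset.mem_neg'] at h3
        refine hc (-x) (by linarith) (by linarith) ?_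
        push_cast
        exact h3⟩
    obtain ⟨x, e1, e2, e3⟩ := hcon (-(u + l) + 1)
    refine hu (-x) (by linarith) (by linarith) ?_
    rw [Finset.mem_neg']
    push_cast
    simpa using e3
  obtain ⟨b₀, s, hs, hb0, hb1, hBs, u, hu1, hu2, hu⟩ :=
    exists_span_of_gap hA hw hBD (by omega) hMg hgA hB hgap
  refine ⟨b₀, s, ?_, hBs⟩
  set B' : Finset ℤ := (Finset.Icc (0 : ℤ) s).filter (fun x => ((b₀ + x : ℤ) : ZMod p) ∈ B)
    with hB'
  have hB'sub : B' ⊆ Finset.Icc 0 (s : ℤ) := Finset.filter_subset _ _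
  have hres : residues p B' = B.image (fun b => b - (b₀ : ZMod p)) := by
    ext r
    rw [mem_residues, Finset.mem_image]
    constructor
    · rintro ⟨x, hx, rfl⟩
      refine ⟨_, (Finset.mem_filter.1 hx).2, ?_⟩
      push_cast
      ring
    · rintro ⟨b, hb, rfl⟩
      obtain ⟨i, hi, rfl⟩ := hBs b hb
      refine ⟨i, ?_, by push_cast; ring⟩
      rw [hB', Finset.mem_filter, Finset.mem_Icc]
      refine ⟨⟨by omega, by omega⟩, ?_⟩
      push_cast
      exact hb
  -- Because s + l < p, the integer sumset does not wrap around.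
  have hAB : A + B' ⊆ Finset.Ico (0 : ℤ) (0 + p) := by
    intro x hx
    obtain ⟨a, ha, b, hb, rfl⟩ := Finset.mem_add.1 hx
    have e1 := Finset.mem_Icc.1 (hA.subset ha)
    have e2 := Finset.mem_Icc.1 (hB'sub hb)
    rw [Finset.mem_Ico]
    omega
  have hB'c : B'.card = B.card := by
    have : B' ⊆ Finset.Ico (0 : ℤ) (0 + p) := by
      intro x hx
      have e2 := Finset.mem_Icc.1 (hB'sub hx)
      rw [Finset.mem_Ico]
      omega
    rw [← card_residues_of_subset_Ico this, hres,
      Finset.card_image_of_injective _ (sub_left_injective)]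
  have himg : residues p (A + B') = (residues p A + B).image (fun b => b - (b₀ : ZMod p)) := by
    rw [residues_add, hres]
    ext r
    simp only [Finset.mem_add, Finset.mem_image]
    constructor
    · rintro ⟨x, hx, _, ⟨b, hb, rfl⟩, rfl⟩
      exact ⟨x + b, ⟨x, hx, b, hb, rfl⟩, by ring⟩
    · rintro ⟨_, ⟨x, hx, b, hb, rfl⟩, rfl⟩
      exact ⟨x, hx, _, ⟨b, hb, rfl⟩, by ring⟩
  have hABc : (A + B').card = (residues p A + B).card := by
    rw [← card_residues_of_subset_Ico hAB, himg,
      Finset.card_image_of_injective _ (sub_left_injective)]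
  have hsB : B.card ≤ s + 1 := by
    have := Finset.card_le_card hB'sub
    rw [Int.card_Icc] at this
    omega
  have hM : 0 < M := by
    by_contra! h
    have : M = 0 := by omega
    subst this
    omega
  have hMl : 1 ≤ M * ((J + 2) * l) := Nat.one_le_iff_ne_zero.2 (by positivity)
  rw [← hABc]
  apply length_add_card_le_of_Ico_subset (u := u - b₀) (by omega) hA.subset ⟨0, hA.zero_mem⟩ hB'sub
  · rw [hB', Finset.mem_filter, Finset.mem_Icc]
    exact ⟨⟨le_rfl, by omega⟩, by simpa using hb0⟩
  · rw [hB', Finset.mem_filter, Finset.mem_Icc]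
    exact ⟨⟨by omega, le_rfl⟩, hb1⟩
  · intro x hx
    rw [Finset.mem_Ico] at hx
    have h1 := hu (b₀ + x) (by linarith) (by linarith)
    rw [hDdef, Finset.mem_compl, not_not] at h1
    have h2 : (x : ZMod p) ∈ residues p (A + B') := by
      rw [himg, Finset.mem_image]
      exact ⟨_, h1, by push_cast; ring⟩
    obtain ⟨y, hy, hyx⟩ := mem_residues.1 h2
    have h3 := Finset.mem_Ico.1 (hAB hy)
    have h4 := (ZMod.intCast_eq_intCast_iff_dvd_sub y x p).1 hyx
    have : x - y = 0 := Int.eq_zero_of_abs_lt_dvd h4 (by rw [abs_lt]; constructor <;> omega)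
    have : x = y := by linarith
    rwa [this]
  · omega

end Cyclic

/-! ### Plünnecke–Petridis bounds for sums of a set that barely enlarges S. -/

section Pluennecke

variable {p : ℕ} [Fact p.Prime]

/-- A set with `|X + S| ≤ K |S|` has iterated sumsets of size at most `(K ^ j - 1) |S| + 1`. -/
theorem card_iterSum_le_of_card_add_le (X S : Finset (ZMod p)) (hX : X.Nonempty)
    (hS : S.Nonempty) {K : ℝ} (hK1 : 1 ≤ K) (hK : ((X + S).card : ℝ) ≤ K * S.card) (j : ℕ)
    (hp : K ^ j * S.card < p) : ((iterSum X j).card : ℝ) ≤ (K ^ j - 1) * S.card + 1 := by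
  classical
  obtain ⟨T, hT, hmin⟩ := Finset.exists_min_image (S.powerset.erase ∅)
    (fun T => ((T + X).card : ℝ) / T.card)
    ⟨S, by simp [hS.ne_empty]⟩
  rw [Finset.mem_erase, Finset.mem_powerset] at hT
  obtain ⟨hT0, hTS⟩ := hT
  have hTne : T.Nonempty := Finset.nonempty_iff_ne_empty.2 hT0
  have hTpos : (0 : ℝ) < T.card := by exact_mod_cast hTne.card_pos
  have hSpos : (0 : ℝ) < S.card := by exact_mod_cast hS.card_pos
  have hTle : (T.card : ℝ) ≤ S.card := by exact_mod_cast Finset.card_le_card hTS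
  have hTK : ((T + X).card : ℝ) ≤ K * T.card := by
    have h1 := hmin S (by simp [hS.ne_empty])
    have h2 : ((S + X).card : ℝ) / S.card ≤ K := by
      rw [div_le_iff₀ hSpos, add_comm S X]
      exact hK
    have h3 := h1.trans h2
    rwa [div_le_iff₀ hTpos] at h3
  have hpet : ∀ T' ⊆ T, (T + X).card * T'.card ≤ (T' + X).card * T.card := by
    intro T' hT'
    rcases T'.eq_empty_or_nonempty with rfl | hne
    · simp
    · have h1 := hmin T' (by simp [hne.ne_empty, hT'.trans hTS])
      have hpos : (0 : ℝ) < T'.card := by exact_mod_cast hne.card_pos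
      rw [div_le_div_iff₀ hTpos hpos] at h1
      exact_mod_cast h1
  have hgrow : ∀ i, ((iterSum X i + T).card : ℝ) ≤ K ^ i * T.card := by
    intro i
    induction i with
    | zero => simp [iterSum, Finset.singleton_add]
    | succ i ih =>
      have h1 := Finset.pluennecke_petridis_inequality_add (iterSum X i) hpet
      have e : iterSum X (i + 1) + T = iterSum X i + T + X := by
        change iterSum X i + X + T = _
        rw [add_assoc, add_comm X T, add_assoc]
      rw [e]
      have h2 : ((iterSum X i + T + X).card : ℝ) * T.card ≤
          (T + X).card * (iterSum X i + T).card := by exact_mod_cast h1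
      have h3 : ((T + X).card : ℝ) * (iterSum X i + T).card ≤
          (K * T.card) * (K ^ i * T.card) := by
        apply mul_le_mul hTK ih <;> positivity
      have h4 := h2.trans h3
      have e2 : (K * T.card) * (K ^ i * T.card) = (K ^ (i + 1) * T.card) * (T.card : ℝ) := by ring
      rw [e2] at h4
      exact le_of_mul_le_mul_right h4 hTpos
  have hKj : 1 ≤ K ^ j := one_le_pow₀ hK1
  have hlt : ((iterSum X j + T).card : ℝ) < p := by
    refine lt_of_le_of_lt (hgrow j) (lt_of_le_of_lt ?_ hp)
    exact mul_le_mul_of_nonneg_left hTle (by positivity)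
  have hlt' : (iterSum X j + T).card < p := by exact_mod_cast hlt
  -- Cauchy–Davenport removes |T| from the Petridis bound K ^ j |T|. With K = 1 + g/|S| what remains
  -- is about jg, independent of the size of S.
  have hcd := ZMod.cauchy_davenport (Fact.out : p.Prime) (iterSum_nonempty hX j) hTne
  have hcd' : (iterSum X j).card + T.card - 1 ≤ (iterSum X j + T).card := by
    rcases min_le_iff.1 hcd with h | h
    · omega
    · exact h
  have hcd2 : ((iterSum X j).card : ℝ) + T.card ≤ (iterSum X j + T).card + 1 := by
    have : (iterSum X j).card + T.card ≤ (iterSum X j + T).card + 1 := by omega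
    exact_mod_cast this
  have := hgrow j
  nlinarith

end Pluennecke

/-! ### Rectification: affine copies of integer sets. -/

section AffineImage

variable {p : ℕ}

/-- The set of residues `c + d z`, for `z ∈ A`. -/
def affineImage (c d : ZMod p) (A : Finset ℤ) : Finset (ZMod p) :=
  A.image (fun z : ℤ => c + d * z)

theorem mem_affineImage {c d : ZMod p} {A : Finset ℤ} {x : ZMod p} :
    x ∈ affineImage c d A ↔ ∃ z ∈ A, c + d * z = x := by
  simp [affineImage]

theorem affineImage_image (c d : ZMod p) (e f : ℤ) (A : Finset ℤ) :
    affineImage c d (A.image (fun z => e + f * z)) = affineImage (c + d * (e : ZMod p)) (d * (f : ZMod p)) A := by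
  unfold affineImage
  rw [Finset.image_image]
  congr 1
  ext z
  simp only [Function.comp]
  push_cast
  ring

theorem affineImage_add (c c' d : ZMod p) (A B : Finset ℤ) :
    affineImage c d A + affineImage c' d B = affineImage (c + c') d (A + B) := by
  ext x
  simp only [Finset.mem_add, mem_affineImage]
  constructor
  · rintro ⟨_, ⟨a, ha, rfl⟩, _, ⟨b, hb, rfl⟩, rfl⟩
    exact ⟨a + b, ⟨a, ha, b, hb, rfl⟩, by push_cast; ring⟩
  · rintro ⟨_, ⟨a, ha, b, hb, rfl⟩, rfl⟩
    exact ⟨_, ⟨a, ha, rfl⟩, _, ⟨b, hb, rfl⟩, by push_cast; ring⟩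

theorem iterSum_affineImage (c d : ZMod p) (A : Finset ℤ) (j : ℕ) :
    iterSum (affineImage c d A) j = affineImage ((j : ZMod p) * c) d (iterSum A j) := by
  induction j with
  | zero => simp [iterSum, affineImage]
  | succ j ih =>
    change iterSum (affineImage c d A) j + affineImage c d A = _
    rw [ih, affineImage_add]
    change affineImage _ d (iterSum A (j + 1)) = _
    congr 1
    push_cast
    ring

theorem iterSum_subset_Icc {A : Finset ℤ} {u w : ℤ} (hA : A ⊆ Finset.Icc u (u + w)) (j : ℕ) :
    iterSum A j ⊆ Finset.Icc (j * u) (j * u + j * w) := by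
  induction j with
  | zero => simp [iterSum]
  | succ j ih =>
    intro x hx
    obtain ⟨y, hy, a, ha, rfl⟩ := Finset.mem_add.1 (show x ∈ iterSum A j + A from hx)
    have h1 := Finset.mem_Icc.1 (ih hy)
    have h2 := Finset.mem_Icc.1 (hA ha)
    rw [Finset.mem_Icc]
    push_cast
    constructor <;> linarith

variable [Fact p.Prime]

theorem card_affineImage {c d : ZMod p} (hd : d ≠ 0) {A : Finset ℤ} {u w : ℤ}
    (hA : A ⊆ Finset.Icc u (u + w)) (hw : w < p) : (affineImage c d A).card = A.card := by
  apply Finset.card_image_of_injOn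
  intro x hx y hy hxy
  have h1 := Finset.mem_Icc.1 (hA hx)
  have h2 := Finset.mem_Icc.1 (hA hy)
  have h3 : (x : ZMod p) = y := mul_left_cancel₀ hd (add_left_cancel hxy)
  have h4 := (ZMod.intCast_eq_intCast_iff_dvd_sub x y p).1 h3
  have : y - x = 0 := Int.eq_zero_of_abs_lt_dvd h4 (by rw [abs_lt]; constructor <;> linarith)
  linarith

theorem card_iterSum_affineImage {c d : ZMod p} (hd : d ≠ 0) {A : Finset ℤ} {u w : ℤ}
    (hA : A ⊆ Finset.Icc u (u + w)) (j : ℕ) (hw : j * w < p) :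
    (iterSum (affineImage c d A) j).card = (iterSum A j).card := by
  rw [iterSum_affineImage]
  exact card_affineImage hd (iterSum_subset_Icc hA j) hw

theorem exists_isNormalized_affineImage {c d : ZMod p} (hd : d ≠ 0) {A : Finset ℤ} {u w : ℤ}
    (hA : A ⊆ Finset.Icc u (u + w)) (hw : w < p) (hA2 : 2 ≤ A.card) :
    ∃ (c' d' : ZMod p) (l : ℕ) (A' : Finset ℤ), d' ≠ 0 ∧ IsNormalized A' l ∧
      affineImage c d A = affineImage c' d' A' ∧ (l : ℤ) ≤ w := by
  obtain ⟨e, f, l, A', hf, hA', rfl⟩ := exists_isNormalized A hA2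
  have h1 := Finset.mem_Icc.1 (hA (Finset.mem_image.2 ⟨0, hA'.zero_mem, rfl⟩))
  have h2 := Finset.mem_Icc.1 (hA (Finset.mem_image.2 ⟨l, hA'.right_mem, rfl⟩))
  have hl : (0 : ℤ) < l := by exact_mod_cast hA'.pos
  refine ⟨c + d * e, d * f, l, A', ?_, hA', affineImage_image c d e f A', by nlinarith⟩
  apply mul_ne_zero hd
  intro h0
  rw [ZMod.intCast_zmod_eq_zero_iff_dvd] at h0
  have := Int.le_of_dvd hf h0
  nlinarith

/-- If a large part of `X` is rectifiable and `X` has doubling less than `5 / 2`, then `X` is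
rectifiable and contained in a short progression. -/
theorem exists_isNormalized_of_card_add_self {X X' : Finset (ZMod p)} (hX : X' ⊆ X)
    {c d : ZMod p} (hd : d ≠ 0) {A : Finset ℤ} {u w : ℤ} (hXA : X' = affineImage c d A)
    (hA : A ⊆ Finset.Icc u (u + w)) (hw : 2 * w < p) (hX2 : 2 ≤ X'.card)
    (hdbl : 2 * (X + X).card + 4 ≤ 5 * X'.card)
    (hp : 6 * (X + X).card < p + 6 * X'.card) :
    ∃ (c' d' : ZMod p) (l : ℕ) (A' : Finset ℤ), d' ≠ 0 ∧ IsNormalized A' l ∧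
      X = affineImage c' d' A' ∧ l + X.card ≤ (X + X).card := by
  classical
  have hA2 : 2 ≤ A.card := by
    rw [hXA] at hX2
    exact hX2.trans Finset.card_image_le
  have hne : A.Nonempty := Finset.card_pos.1 (by omega)
  have hw0 : 0 ≤ w := by
    obtain ⟨a, ha⟩ := hne
    have := Finset.mem_Icc.1 (hA ha)
    linarith
  obtain ⟨c', d', l, A', hd', hA', hXA', hl⟩ :=
    exists_isNormalized_affineImage (c := c) hd hA (by linarith) hA2
  rw [hXA'] at hXA
  have hsub0 : A' ⊆ Finset.Icc 0 (0 + (l : ℤ)) := by simpa using hA'.subset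
  have hc1 : X'.card = A'.card := by
    rw [hXA]
    exact card_affineImage hd' hsub0 (by linarith)
  have hc2 : (X' + X').card = (A' + A').card := by
    have := card_iterSum_affineImage (c := c') hd' hsub0 2 (by push_cast; linarith)
    rwa [iterSum_two, iterSum_two, ← hXA] at this
  have hmono : (X' + X').card ≤ (X + X).card := Finset.card_le_card (Finset.add_subset_add hX hX)
  have hl1 := hA'.add_card_le_of_card_add_self (by omega)
  have hl6 : 6 * l < p := by omega
  have hlow := card_iterSum_ge ⟨0, hA'.zero_mem⟩ 2
  rw [iterSum_two] at hlow
  -- If y + X' missed 2X', then 2X would have at least 3|X'| - 1 elements. So y ∈ 2X' - X', at a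
  -- position in [-l, 2l].
  have hcover : ∀ y ∈ X, ∃ z ∈ Finset.Icc (-(l : ℤ)) (-l + 3 * l), y = c' + d' * z := by
    intro y hy
    have hnd : ¬ Disjoint (X' + X') (y +ᵥ X') := by
      intro hdisj
      have hs : (X' + X') ∪ (y +ᵥ X') ⊆ X + X := by
        apply Finset.union_subset (Finset.add_subset_add hX hX)
        intro x hx
        obtain ⟨x', hx', rfl⟩ := Finset.mem_vadd_finset.1 hx
        exact Finset.add_mem_add hy (hX hx')
      have := Finset.card_le_card hs
      rw [Finset.card_union_of_disjoint hdisj, Finset.card_vadd_finset] at this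
      omega
    rw [Finset.not_disjoint_iff] at hnd
    obtain ⟨x, hx1, hx2⟩ := hnd
    rw [hXA, affineImage_add] at hx1
    obtain ⟨v, hv, rfl⟩ := mem_affineImage.1 hx1
    obtain ⟨x', hx', hxy⟩ := Finset.mem_vadd_finset.1 hx2
    rw [hXA] at hx'
    obtain ⟨t, ht, rfl⟩ := mem_affineImage.1 hx'
    obtain ⟨v1, hv1, v2, hv2, rfl⟩ := Finset.mem_add.1 hv
    have e1 := Finset.mem_Icc.1 (hA'.subset hv1)
    have e2 := Finset.mem_Icc.1 (hA'.subset hv2)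
    have e3 := Finset.mem_Icc.1 (hA'.subset ht)
    refine ⟨v1 + v2 - t, ?_, ?_⟩
    · rw [Finset.mem_Icc]
      constructor <;> linarith
    · simp only [vadd_eq_add] at hxy
      push_cast at hxy ⊢
      linear_combination hxy
  set B : Finset ℤ := (Finset.Icc (-(l : ℤ)) (-l + 3 * l)).filter (fun z : ℤ => c' + d' * z ∈ X)
    with hB
  have hXB : X = affineImage c' d' B := by
    ext y
    rw [mem_affineImage]
    constructor
    · intro hy
      obtain ⟨z, hz, rfl⟩ := hcover y hy
      exact ⟨z, Finset.mem_filter.2 ⟨hz, hy⟩, rfl⟩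
    · rintro ⟨z, hz, rfl⟩
      exact (Finset.mem_filter.1 hz).2
  have hBsub : B ⊆ Finset.Icc (-(l : ℤ)) (-l + 3 * l) := Finset.filter_subset _ _
  have hXX := Finset.card_le_card hX
  have hcB : X.card = B.card := by
    conv_lhs => rw [hXB]
    exact card_affineImage hd' hBsub (by omega)
  obtain ⟨c₂, d₂, l₂, A₂, hd₂, hA₂, hXA₂, hl₂⟩ :=
    exists_isNormalized_affineImage (c := c') hd' hBsub (by omega) (by omega)
  rw [← hXB] at hXA₂
  refine ⟨c₂, d₂, l₂, A₂, hd₂, hA₂, hXA₂, ?_⟩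
  have hsub₂ : A₂ ⊆ Finset.Icc 0 (0 + (l₂ : ℤ)) := by simpa using hA₂.subset
  have hc3 : X.card = A₂.card := by
    conv_lhs => rw [hXA₂]
    exact card_affineImage hd₂ hsub₂ (by omega)
  have hc4 : (X + X).card = (A₂ + A₂).card := by
    have := card_iterSum_affineImage (c := c₂) hd₂ hsub₂ 2 (by push_cast; omega)
    rwa [iterSum_two, iterSum_two, ← hXA₂] at this
  have := hA₂.add_card_le_of_card_add_self (by omega)
  omega

/-- If a large part of `X` is rectifiable of order `6` and the iterated sumsets of `X` are small,
then `X` is rectifiable and contained in a progression of length less than `2.7 |X|`. -/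
theorem exists_isNormalized_of_card_iterSum (hp2 : p ≠ 2) {X X' : Finset (ZMod p)} (hX : X' ⊆ X)
    {c d : ZMod p} (hd : d ≠ 0) {A : Finset ℤ} {u w : ℤ} (hXA : X' = affineImage c d A)
    (hA : A ⊆ Finset.Icc u (u + w)) (hw : 6 * w < p) (hX2 : 2 ≤ X'.card)
    (h6 : 10 * (iterSum X 6).card + 114 < 124 * X'.card)
    (h4 : (iterSum X 4).card + 6 < 9 * X'.card) (hp : 230 * X.card ≤ p) :
    ∃ (c' d' : ZMod p) (l : ℕ) (A' : Finset ℤ), d' ≠ 0 ∧ IsNormalized A' l ∧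
      X = affineImage c' d' A' ∧ 10 * l ≤ 27 * (X.card - 1) := by
  classical
  have hA2 : 2 ≤ A.card := by
    rw [hXA] at hX2
    exact hX2.trans Finset.card_image_le
  have hne : A.Nonempty := Finset.card_pos.1 (by omega)
  have hw0 : 0 ≤ w := by
    obtain ⟨a, ha⟩ := hne
    have := Finset.mem_Icc.1 (hA ha)
    linarith
  obtain ⟨c', d', l, A', hd', hA', hXA', hl⟩ :=
    exists_isNormalized_affineImage (c := c) hd hA (by linarith) hA2
  rw [hXA'] at hXA
  have hsub0 : A' ⊆ Finset.Icc 0 (0 + (l : ℤ)) := by simpa using hA'.subset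
  have hcj : ∀ j : ℕ, j ≤ 6 → (iterSum X' j).card = (iterSum A' j).card := by
    intro j hj
    rw [hXA]
    apply card_iterSum_affineImage hd' hsub0
    have : (j : ℤ) ≤ 6 := by exact_mod_cast hj
    nlinarith
  have hc1 : X'.card = A'.card := by
    have := hcj 1 (by norm_num)
    rwa [iterSum_one, iterSum_one] at this
  have hXX := Finset.card_le_card hX
  have h66 := Finset.card_le_card (iterSum_mono hX 6)
  have hl1 := hA'.length_le_of_card_iterSum_six (by
    have := hcj 6 le_rfl
    omega)
  have hlow2 := card_iterSum_ge ⟨0, hA'.zero_mem⟩ 2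
  have hlow3 := card_iterSum_ge ⟨0, hA'.zero_mem⟩ 3
  have hlow4 := card_iterSum_ge ⟨0, hA'.zero_mem⟩ 4
  rw [← hcj _ (by norm_num)] at hlow2 hlow3 hlow4
  -- 84 = 6 · 14: sixfold sums from an interval of length 14l must not wrap around.
  have h84 : 84 * l < p := by omega
  have h2ne : (2 : ZMod p) ≠ 0 := by
    intro h
    have h2 : ((2 : ℕ) : ZMod p) = 0 := by exact_mod_cast h
    rw [ZMod.natCast_eq_zero_iff] at h2
    exact hp2 ((Nat.prime_dvd_prime_iff_eq (Fact.out : p.Prime) Nat.prime_two).1 h2)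
  have hmem : ∀ j x, x ∈ iterSum X' j →
      ∃ v : ℤ, 0 ≤ v ∧ v ≤ j * l ∧ x = j * c' + d' * v := by
    intro j x hx
    rw [hXA, iterSum_affineImage] at hx
    obtain ⟨v, hv, rfl⟩ := mem_affineImage.1 hx
    have := Finset.mem_Icc.1 (iterSum_subset_Icc hsub0 j hv)
    exact ⟨v, by linarith, by linarith, rfl⟩
  -- The sets 4X', y + 3X', 2y + 2X' lie in 4X and have together at least 9|X'| - 6 elements, so two
  -- of them meet. Thus y ∈ 4X' - 3X', y ∈ 3X' - 2X' or 2y ∈ 4X' - 2X'. The last case is why the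
  -- step is halved; in half steps all positions lie in [-6l, 8l].
  have hcover : ∀ y ∈ X, ∃ z ∈ Finset.Icc (-(6 * l : ℤ)) (-(6 * l) + 14 * l),
      y = c' + d' / 2 * z := by
    intro y hy
    have hs4 : iterSum X' 4 ⊆ iterSum X 4 := iterSum_mono hX 4
    have hs3 : y +ᵥ iterSum X' 3 ⊆ iterSum X 4 := by
      intro x hx
      obtain ⟨x', hx', rfl⟩ := Finset.mem_vadd_finset.1 hx
      change _ ∈ iterSum X 3 + X
      rw [vadd_eq_add, add_comm y]
      exact Finset.add_mem_add (iterSum_mono hX 3 hx') hy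
    have hs2 : (y + y) +ᵥ iterSum X' 2 ⊆ iterSum X 4 := by
      intro x hx
      obtain ⟨x', hx', rfl⟩ := Finset.mem_vadd_finset.1 hx
      change _ ∈ iterSum X 2 + X + X
      have e : (y + y) +ᵥ x' = x' + y + y := by rw [vadd_eq_add]; ring
      rw [e]
      exact Finset.add_mem_add (Finset.add_mem_add (iterSum_mono hX 2 hx') hy) hy
    by_cases d1 : Disjoint (iterSum X' 4) (y +ᵥ iterSum X' 3)
    · by_cases d2 : Disjoint (iterSum X' 4 ∪ (y +ᵥ iterSum X' 3)) ((y + y) +ᵥ iterSum X' 2)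
      · exfalso
        have := Finset.card_le_card (Finset.union_subset (Finset.union_subset hs4 hs3) hs2)
        rw [Finset.card_union_of_disjoint d2, Finset.card_union_of_disjoint d1,
          Finset.card_vadd_finset, Finset.card_vadd_finset] at this
        omega
      · rw [Finset.not_disjoint_iff] at d2
        obtain ⟨x, hx1, hx2⟩ := d2
        obtain ⟨x', hx', hxx'⟩ := Finset.mem_vadd_finset.1 hx2
        obtain ⟨v, hv0, hv1, rfl⟩ := hmem 2 x' hx'
        rw [vadd_eq_add] at hxx'
        push_cast at hv1 hxx'
        rcases Finset.mem_union.1 hx1 with hx1 | hx1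
        · obtain ⟨v', hv0', hv1', rfl⟩ := hmem 4 x hx1
          push_cast at hv1' hxx'
          refine ⟨v' - v, ?_, ?_⟩
          · rw [Finset.mem_Icc]
            constructor <;> linarith
          · field_simp
            push_cast
            linear_combination hxx'
        · obtain ⟨x'', hx'', hxx''⟩ := Finset.mem_vadd_finset.1 hx1
          obtain ⟨v', hv0', hv1', rfl⟩ := hmem 3 x'' hx''
          rw [vadd_eq_add, ← hxx'] at hxx''
          push_cast at hv1' hxx''
          refine ⟨2 * (v' - v), ?_, ?_⟩
          · rw [Finset.mem_Icc]
            constructor <;> linarith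
          · field_simp
            push_cast
            linear_combination -2 * hxx''
    · rw [Finset.not_disjoint_iff] at d1
      obtain ⟨x, hx1, hx2⟩ := d1
      obtain ⟨v, hv0, hv1, rfl⟩ := hmem 4 x hx1
      obtain ⟨x', hx', hxx'⟩ := Finset.mem_vadd_finset.1 hx2
      obtain ⟨v', hv0', hv1', rfl⟩ := hmem 3 x' hx'
      rw [vadd_eq_add] at hxx'
      push_cast at hv1 hv1' hxx'
      refine ⟨2 * (v - v'), ?_, ?_⟩
      · rw [Finset.mem_Icc]
        constructor <;> linarith
      · field_simp
        push_cast
        linear_combination 2 * hxx'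
  set B : Finset ℤ := (Finset.Icc (-(6 * l : ℤ)) (-(6 * l) + 14 * l)).filter
    (fun z : ℤ => c' + d' / 2 * z ∈ X) with hB
  have hXB : X = affineImage c' (d' / 2) B := by
    ext y
    rw [mem_affineImage]
    constructor
    · intro hy
      obtain ⟨z, hz, rfl⟩ := hcover y hy
      exact ⟨z, Finset.mem_filter.2 ⟨hz, hy⟩, rfl⟩
    · rintro ⟨z, hz, rfl⟩
      exact (Finset.mem_filter.1 hz).2
  have hBsub : B ⊆ Finset.Icc (-(6 * l : ℤ)) (-(6 * l) + 14 * l) := Finset.filter_subset _ _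
  have hd2 : d' / 2 ≠ 0 := div_ne_zero hd' h2ne
  have hcB : X.card = B.card := by
    conv_lhs => rw [hXB]
    exact card_affineImage hd2 hBsub (by omega)
  obtain ⟨c₂, d₂, l₂, A₂, hd₂, hA₂, hXA₂, hl₂⟩ :=
    exists_isNormalized_affineImage (c := c') hd2 hBsub (by omega) (by omega)
  rw [← hXB] at hXA₂
  refine ⟨c₂, d₂, l₂, A₂, hd₂, hA₂, hXA₂, ?_⟩
  have hsub₂ : A₂ ⊆ Finset.Icc 0 (0 + (l₂ : ℤ)) := by simpa using hA₂.subset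
  have hc3 : X.card = A₂.card := by
    conv_lhs => rw [hXA₂]
    exact card_affineImage hd₂ hsub₂ (by omega)
  have hc4 : (iterSum X 6).card = (iterSum A₂ 6).card := by
    conv_lhs => rw [hXA₂]
    exact card_iterSum_affineImage hd₂ hsub₂ 6 (by push_cast; omega)
  have := hA₂.length_le_of_card_iterSum_six (by omega)
  omega

/-- The form of `exists_interval_of_hasWindowGain` that is invariant under affine maps. -/
theorem exists_progression_of_hasWindowGain {J γ M g l : ℕ} {A : Finset ℤ}
    (hA : IsNormalized A l) (hw : HasWindowGain A l J γ) {X S : Finset (ZMod p)} {c d : ZMod p}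
    (hd : d ≠ 0) (hX : X = affineImage c d A) (hl : l < p)
    (hg : (X + S).card ≤ S.card + g) (hMg : g < M * γ) (hgA : g + 2 < 2 * X.card)
    (hS : M * ((J + 2) * l) + 1 ≤ S.card)
    (hD : (X + S).card + M * ((J + 2) * l) + 1 ≤ p) :
    ∃ (a e : ZMod p) (s : ℕ), e ≠ 0 ∧ s + X.card ≤ (X + S).card ∧
      ∀ b ∈ S, ∃ i : ℕ, i ≤ s ∧ b = a + (i : ZMod p) * e := by
  classical
  have : NeZero p := ⟨(Fact.out : p.Prime).ne_zero⟩
  have hsub0 : A ⊆ Finset.Icc 0 (0 + (l : ℤ)) := by simpa using hA.subset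
  have hXc : X.card = A.card := by
    conv_lhs => rw [hX]
    exact card_affineImage hd hsub0 (by exact_mod_cast hl)
  set B : Finset (ZMod p) := S.image (fun s => d⁻¹ * s) with hB
  have hBc : B.card = S.card :=
    Finset.card_image_of_injective _ (mul_right_injective₀ (inv_ne_zero hd))
  have hABc : (residues p A + B).card = (X + S).card := by
    have : X + S = (residues p A + B).image (fun x => c + d * x) := by
      ext y
      rw [hX]
      simp only [Finset.mem_add, mem_affineImage, Finset.mem_image, mem_residues, hB]
      constructor
      · rintro ⟨_, ⟨z, hz, rfl⟩, s, hs, rfl⟩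
        refine ⟨z + d⁻¹ * s, ⟨z, ⟨z, hz, rfl⟩, _, ⟨s, hs, rfl⟩, rfl⟩, ?_⟩
        field_simp
        ring
      · rintro ⟨_, ⟨_, ⟨z, hz, rfl⟩, _, ⟨s, hs, rfl⟩, rfl⟩, rfl⟩
        refine ⟨_, ⟨z, hz, rfl⟩, s, hs, ?_⟩
        field_simp
        ring
    rw [this, Finset.card_image_of_injective]
    intro x y hxy
    exact mul_left_cancel₀ hd (add_left_cancel hxy)
  obtain ⟨b₀, s, hs, hb⟩ := exists_interval_of_hasWindowGain hA hw (B := B) (g := g) (M := M)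
    (by omega) hMg (by omega) (by omega) (by omega)
  refine ⟨d * b₀, d, s, hd, by omega, ?_⟩
  intro b hbS
  obtain ⟨i, hi, hbi⟩ := hb (d⁻¹ * b) (Finset.mem_image.2 ⟨b, hbS, rfl⟩)
  refine ⟨i, hi, ?_⟩
  have : b = d * (d⁻¹ * b) := by field_simp
  rw [this, hbi]
  ring

/-- A set contained in an interval of a progression is contained in a longer progression. -/
theorem exists_isArithProgOfLength {S : Finset (ZMod p)} {a e : ZMod p} (he : e ≠ 0) {s N : ℕ}
    (hS : ∀ b ∈ S, ∃ i : ℕ, i ≤ s ∧ b = a + (i : ZMod p) * e) (hsN : s + 1 ≤ N) (hN : N ≤ p) :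
    ∃ P : Finset (ZMod p), IsArithProgOfLength P N ∧ S ⊆ P := by
  refine ⟨(Finset.range N).image (fun i : ℕ => a + (i : ZMod p) * e), ⟨?_, a, e, rfl⟩, ?_⟩
  · rw [Finset.card_image_of_injOn, Finset.card_range]
    intro i hi j hj hij
    rw [Finset.mem_coe, Finset.mem_range] at hi hj
    have h1 : (i : ZMod p) = j := mul_right_cancel₀ he (add_left_cancel hij)
    rw [ZMod.natCast_eq_natCast_iff'] at h1
    rwa [Nat.mod_eq_of_lt (by omega), Nat.mod_eq_of_lt (by omega)] at h1
  · intro b hb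
    obtain ⟨i, hi, rfl⟩ := hS b hb
    exact Finset.mem_image.2 ⟨i, Finset.mem_range.2 (by omega), rfl⟩

end AffineImage

/-! ### Exponential sums and concentration on arcs. -/

section Fourier

variable {p : ℕ} [Fact p.Prime]

/-- The exponential sum of `X` at the frequency `r`. -/
noncomputable def expSum (X : Finset (ZMod p)) (r : ZMod p) : ℂ :=
  ∑ x ∈ X, ZMod.stdAddChar (r * x)

theorem star_stdAddChar (x : ZMod p) :
    (starRingEnd ℂ) (ZMod.stdAddChar x) = ZMod.stdAddChar (-x) := by
  rw [AddChar.map_neg_eq_conj]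

theorem norm_stdAddChar (x : ZMod p) : ‖(ZMod.stdAddChar x : ℂ)‖ = 1 :=
  AddChar.norm_apply _ _

theorem sum_stdAddChar_mul (t : ZMod p) :
    ∑ r : ZMod p, (ZMod.stdAddChar (r * t) : ℂ) = if t = 0 then (p : ℂ) else 0 := by
  have := AddChar.sum_mulShift t (ZMod.isPrimitive_stdAddChar p)
  rw [ZMod.card] at this
  rw [this]
  split_ifs <;> simp

theorem sum_norm_sq_expSum (X : Finset (ZMod p)) :
    ∑ r : ZMod p, ‖expSum X r‖ ^ 2 = (p : ℝ) * X.card := by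
  have key : ∑ r : ZMod p, expSum X r * (starRingEnd ℂ) (expSum X r) = (p : ℂ) * X.card := by
    unfold expSum
    simp only [map_sum, star_stdAddChar, Finset.sum_mul_sum, ← AddChar.map_add_eq_mul]
    rw [Finset.sum_comm]
    have : ∀ x ∈ X, ∑ r : ZMod p, ∑ y ∈ X, (ZMod.stdAddChar (r * x + -(r * y)) : ℂ) = p := by
      intro x hx
      rw [Finset.sum_comm]
      have h1 : ∀ y ∈ X, ∑ r : ZMod p, (ZMod.stdAddChar (r * x + -(r * y)) : ℂ) =
          if y = x then (p : ℂ) else 0 := by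
        intro y _
        have h2 := sum_stdAddChar_mul (x - y)
        simp only [sub_eq_zero, eq_comm (a := x)] at h2
        rw [← h2]
        refine Finset.sum_congr rfl fun r _ => ?_
        congr 1
        ring
      rw [Finset.sum_congr rfl h1, Finset.sum_ite_eq' X x, if_pos hx]
    rw [Finset.sum_congr rfl this]
    simp [mul_comm]
  have h : ((∑ r : ZMod p, ‖expSum X r‖ ^ 2 : ℝ) : ℂ) = ((p : ℝ) * X.card : ℝ) := by
    push_cast
    rw [← key]
    refine Finset.sum_congr rfl fun r _ => ?_
    rw [Complex.mul_conj, Complex.normSq_eq_norm_sq]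
    push_cast
    rfl
  exact_mod_cast h

theorem expSum_zero (X : Finset (ZMod p)) : expSum X 0 = X.card := by
  simp [expSum]

/-- The sum is p times the number of solutions of x + s = y. -/
theorem sum_expSum_mul_eq_zero (X S Y : Finset (ZMod p)) (hY : ∀ x ∈ X, ∀ s ∈ S, x + s ∉ Y) :
    ∑ r : ZMod p, expSum X r * expSum S r * (starRingEnd ℂ) (expSum Y r) = 0 := by
  have h : ∀ r : ZMod p, expSum X r * expSum S r * (starRingEnd ℂ) (expSum Y r) =
      ∑ x ∈ X, ∑ s ∈ S, ∑ y ∈ Y, (ZMod.stdAddChar (r * (x + s - y)) : ℂ) := by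
    intro r
    unfold expSum
    rw [map_sum, Finset.sum_mul_sum, Finset.sum_mul]
    refine Finset.sum_congr rfl fun x _ => ?_
    rw [Finset.sum_mul_sum]
    refine Finset.sum_congr rfl fun s _ => Finset.sum_congr rfl fun y _ => ?_
    rw [star_stdAddChar, ← AddChar.map_add_eq_mul, ← AddChar.map_add_eq_mul]
    congr 1
    ring
  simp_rw [h]
  rw [Finset.sum_comm]
  refine Finset.sum_eq_zero fun x hx => ?_
  rw [Finset.sum_comm]
  refine Finset.sum_eq_zero fun s hs => ?_
  rw [Finset.sum_comm]
  refine Finset.sum_eq_zero fun y hy => ?_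
  rw [sum_stdAddChar_mul, if_neg]
  intro h0
  apply hY x hx s hs
  rw [sub_eq_zero.1 h0]
  exact hy

/-- If `X + S` misses a large set `Y`, then `X` has a large exponential sum. -/
theorem exists_expSum_ge (X S Y : Finset (ZMod p)) (hY : ∀ x ∈ X, ∀ s ∈ S, x + s ∉ Y)
    (hS : S.Nonempty) (hYne : Y.Nonempty) :
    ∃ r : ZMod p, r ≠ 0 ∧ (X.card : ℝ) ^ 2 * (S.card * Y.card) ≤
      ‖expSum X r‖ ^ 2 * ((p - S.card) * (p - Y.card)) := by
  classical
  have hp1 : 1 < p := (Fact.out : p.Prime).one_lt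
  obtain ⟨r₀, hr₀, hmax⟩ := Finset.exists_max_image (Finset.univ.erase (0 : ZMod p))
    (fun r => ‖expSum X r‖) ⟨1, by
      have : Fact (1 < p) := ⟨hp1⟩
      simp⟩
  refine ⟨r₀, (Finset.mem_erase.1 hr₀).1, ?_⟩
  set T := ‖expSum X r₀‖
  have hT : 0 ≤ T := norm_nonneg _
  have h0 := sum_expSum_mul_eq_zero X S Y hY
  rw [← Finset.add_sum_erase _ _ (Finset.mem_univ (0 : ZMod p))] at h0
  simp only [expSum_zero, Complex.conj_natCast] at h0
  have h1 : (X.card : ℝ) * S.card * Y.card =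
      ‖∑ r ∈ Finset.univ.erase (0 : ZMod p), expSum X r * expSum S r *
        (starRingEnd ℂ) (expSum Y r)‖ := by
    rw [← neg_eq_of_add_eq_zero_right h0, norm_neg]
    simp
  have h2 : (X.card : ℝ) * S.card * Y.card ≤
      T * ∑ r ∈ Finset.univ.erase (0 : ZMod p), ‖expSum S r‖ * ‖expSum Y r‖ := by
    rw [h1, Finset.mul_sum]
    refine (norm_sum_le _ _).trans (Finset.sum_le_sum fun r hr => ?_)
    rw [norm_mul, norm_mul, RCLike.norm_conj, mul_assoc]
    exact mul_le_mul_of_nonneg_right (hmax r hr) (by positivity)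
  have hpars : ∀ Z : Finset (ZMod p), ∑ r ∈ Finset.univ.erase (0 : ZMod p), ‖expSum Z r‖ ^ 2 =
      (Z.card : ℝ) * (p - Z.card) := by
    intro Z
    have := sum_norm_sq_expSum Z
    rw [← Finset.add_sum_erase _ _ (Finset.mem_univ (0 : ZMod p)), expSum_zero] at this
    rw [Complex.norm_natCast] at this
    linarith
  have h3 := Finset.sum_mul_sq_le_sq_mul_sq (Finset.univ.erase (0 : ZMod p))
    (fun r => ‖expSum S r‖) (fun r => ‖expSum Y r‖)
  rw [hpars, hpars] at h3
  set Q := ∑ r ∈ Finset.univ.erase (0 : ZMod p), ‖expSum S r‖ * ‖expSum Y r‖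
  have hS0 : (0 : ℝ) < S.card := by exact_mod_cast hS.card_pos
  have hY0 : (0 : ℝ) < Y.card := by exact_mod_cast hYne.card_pos
  have h4 : ((X.card : ℝ) * S.card * Y.card) ^ 2 ≤ T ^ 2 * Q ^ 2 := by
    rw [← mul_pow]
    exact pow_le_pow_left₀ (by positivity) h2 2
  have h5 : T ^ 2 * Q ^ 2 ≤
      T ^ 2 * ((S.card * (p - S.card)) * (Y.card * (p - Y.card))) :=
    mul_le_mul_of_nonneg_left h3 (by positivity)
  have h6 := h4.trans h5
  have h7 : ((X.card : ℝ) ^ 2 * (S.card * Y.card)) * (S.card * Y.card) ≤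
      (T ^ 2 * ((p - S.card) * (p - Y.card))) * (S.card * Y.card) := by
    calc _ = ((X.card : ℝ) * S.card * Y.card) ^ 2 := by ring
      _ ≤ _ := h6
      _ = _ := by ring
  exact le_of_mul_le_mul_right h7 (by positivity)

theorem stdAddChar_re_mul_exp (t : ℤ) (φ : ℝ) :
    ((ZMod.stdAddChar ((t : ZMod p)) : ℂ) * Complex.exp (-(φ * Complex.I))).re =
      Real.cos (2 * Real.pi * t / p - φ) := by
  rw [ZMod.stdAddChar_coe, ← Complex.exp_add]
  have : 2 * (Real.pi : ℂ) * Complex.I * t / p + -(φ * Complex.I) =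
      ((2 * Real.pi * t / p - φ : ℝ) : ℂ) * Complex.I := by
    push_cast
    ring
  rw [this, Complex.exp_ofReal_mul_I_re]

theorem exists_exp_mul_eq_norm (z : ℂ) :
    ∃ φ : ℝ, z * Complex.exp (-(φ * Complex.I)) = ‖z‖ := by
  refine ⟨Complex.arg z, ?_⟩
  conv_lhs => rw [← Complex.norm_mul_exp_arg_mul_I z]
  rw [mul_assoc, ← Complex.exp_add]
  simp

/-- If the exponential sum of `X` at `r ≠ 0` is large, then most of `r X` lies on a short arc. -/
theorem exists_arc (X : Finset (ZMod p)) {r : ZMod p} (hr : r ≠ 0) {α : ℝ} (hα0 : 0 ≤ α)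
    (hα : α ≤ Real.pi) :
    ∃ (A : Finset ℤ) (u w : ℤ), A ⊆ Finset.Icc u (u + w) ∧ Real.pi * w ≤ α * p ∧
      affineImage 0 r⁻¹ A ⊆ X ∧
      ‖expSum X r‖ ≤ (affineImage 0 r⁻¹ A).card +
        (X.card - (affineImage 0 r⁻¹ A).card) * Real.cos α := by
  classical
  have hp0 : (0 : ℝ) < p := by exact_mod_cast (Fact.out : p.Prime).pos
  have hpi := Real.pi_pos
  obtain ⟨φ, hφ⟩ := exists_exp_mul_eq_norm (expSum X r)
  -- Centre and half-length of the arc, with angles converted to residues by the factor p/2π.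
  set c : ℝ := φ * p / (2 * Real.pi) with hc
  set e : ℝ := α * p / (2 * Real.pi) with he
  set u : ℤ := ⌈c - e⌉ with hu
  set v : ℤ := ⌊c + e⌋ with hv
  set A : Finset ℤ := (Finset.Icc u (u + (v - u))).filter (fun t : ℤ => r⁻¹ * (t : ZMod p) ∈ X)
    with hA
  have hAX : affineImage 0 r⁻¹ A ⊆ X := by
    intro x hx
    obtain ⟨t, ht, rfl⟩ := mem_affineImage.1 hx
    rw [zero_add]
    exact (Finset.mem_filter.1 ht).2
  have hcos : ∀ x ∈ X, ∃ y : ℝ, ((ZMod.stdAddChar (r * x) : ℂ) *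
      Complex.exp (-(φ * Complex.I))).re = y ∧ y ≤ 1 ∧
      (x ∉ affineImage 0 r⁻¹ A → y ≤ Real.cos α) := by
    intro x hx
    refine ⟨_, rfl, ?_, ?_⟩
    · refine (Complex.re_le_norm _).trans ?_
      rw [norm_mul, norm_stdAddChar]
      have : -((φ : ℂ) * Complex.I) = ((-φ : ℝ) : ℂ) * Complex.I := by push_cast; ring
      rw [this, Complex.norm_exp_ofReal_mul_I, one_mul]
    · intro hxA
      by_contra! hcon
      apply hxA
      obtain ⟨t₀, ht₀⟩ := ZMod.intCast_surjective (r * x)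
      set θ : ℝ := 2 * Real.pi * t₀ / p - φ with hθ
      set k : ℤ := round (θ / (2 * Real.pi)) with hk
      have h1 := abs_sub_round (θ / (2 * Real.pi))
      rw [← hk] at h1
      have h2 : |θ - k * (2 * Real.pi)| ≤ Real.pi := by
        have : θ - k * (2 * Real.pi) = (θ / (2 * Real.pi) - k) * (2 * Real.pi) := by
          field_simp
        rw [this, abs_mul, abs_of_pos (by positivity : 0 < 2 * Real.pi)]
        nlinarith
      have h3 : Real.cos α < Real.cos |θ - k * (2 * Real.pi)| := by
        rw [Real.cos_abs, Real.cos_sub_int_mul_two_pi, hθ, ← stdAddChar_re_mul_exp, ht₀]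
        exact hcon
      have h4 : |θ - k * (2 * Real.pi)| < α := by
        by_contra! h
        have := Real.cos_le_cos_of_nonneg_of_le_pi hα0 h2 h
        linarith
      have hcast : ((t₀ - k * p : ℤ) : ZMod p) = r * x := by
        push_cast
        rw [ht₀]
        simp
      have h5 : |((t₀ - k * p : ℤ) : ℝ) - c| < e := by
        have : ((t₀ - k * p : ℤ) : ℝ) - c = (θ - k * (2 * Real.pi)) * (p / (2 * Real.pi)) := by
          rw [hθ, hc]
          push_cast
          field_simp
          ring
        rw [this, abs_mul, abs_of_pos (by positivity : 0 < (p : ℝ) / (2 * Real.pi)), he,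
          mul_div_assoc]
        exact mul_lt_mul_of_pos_right h4 (by positivity)
      rw [abs_lt] at h5
      refine mem_affineImage.2 ⟨t₀ - k * p, ?_, ?_⟩
      · rw [hA, Finset.mem_filter, Finset.mem_Icc]
        refine ⟨⟨?_, ?_⟩, ?_⟩
        · rw [hu, Int.ceil_le]
          linarith
        · have : t₀ - k * p ≤ v := by
            rw [hv, Int.le_floor]
            linarith
          linarith
        · rw [hcast, inv_mul_cancel_left₀ hr]
          exact hx
      · rw [hcast, inv_mul_cancel_left₀ hr, zero_add]
  refine ⟨A, u, v - u, Finset.filter_subset _ _, ?_, hAX, ?_⟩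
  · have h1 : (v : ℝ) ≤ c + e := Int.floor_le _
    have h2 : c - e ≤ u := Int.le_ceil _
    have h3 : Real.pi * (2 * e) = α * p := by
      rw [he]
      field_simp
    push_cast
    nlinarith
  · set X' := affineImage 0 r⁻¹ A with hX'
    have h1 : ‖expSum X r‖ = ∑ x ∈ X, ((ZMod.stdAddChar (r * x) : ℂ) *
        Complex.exp (-(φ * Complex.I))).re := by
      have := congrArg Complex.re hφ
      rw [Complex.ofReal_re] at this
      rw [← this, expSum, Finset.sum_mul, Complex.re_sum]
    rw [h1, ← Finset.sum_sdiff hAX]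
    have h2 : ∑ x ∈ X \ X', ((ZMod.stdAddChar (r * x) : ℂ) *
        Complex.exp (-(φ * Complex.I))).re ≤ (X \ X').card • Real.cos α := by
      apply Finset.sum_le_card_nsmul
      intro x hx
      rw [Finset.mem_sdiff] at hx
      obtain ⟨y, hy, -, h⟩ := hcos x hx.1
      rw [hy]
      exact h hx.2
    have h3 : ∑ x ∈ X', ((ZMod.stdAddChar (r * x) : ℂ) *
        Complex.exp (-(φ * Complex.I))).re ≤ X'.card • (1 : ℝ) := by
      apply Finset.sum_le_card_nsmul
      intro x hx
      obtain ⟨y, hy, h, -⟩ := hcos x (hAX hx)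
      rw [hy]
      exact h
    rw [nsmul_eq_mul, Finset.cast_card_sdiff hAX] at h2
    rw [nsmul_eq_mul, mul_one] at h3
    linarith

/-- The geometric sum over a half circle has absolute value at least `p / π`. -/
theorem le_norm_sum_halfCircle {h : ℕ} (hp : p = 2 * h + 1) :
    (p : ℝ) ≤ Real.pi * ‖∑ i ∈ Finset.range (h + 1), (ZMod.stdAddChar ((i : ℕ) : ZMod p) : ℂ)‖ := by
  have hp0 : (0 : ℝ) < p := by exact_mod_cast (Fact.out : p.Prime).pos
  have hp1 : (1 : ℝ) < p := by exact_mod_cast (Fact.out : p.Prime).one_lt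
  have hpi := Real.pi_pos
  set ω : ℂ := ZMod.stdAddChar (1 : ZMod p) with hω
  have hpow : ∀ i : ℕ, (ZMod.stdAddChar ((i : ℕ) : ZMod p) : ℂ) = ω ^ i := by
    intro i
    rw [hω, ← AddChar.map_nsmul_eq_pow]
    simp
  have hexp : ∀ i : ℕ, ω ^ i = Complex.exp (Complex.I * ((2 * Real.pi * i / p : ℝ) : ℂ)) := by
    intro i
    rw [← hpow]
    have := ZMod.stdAddChar_coe (N := p) (i : ℤ)
    push_cast at this ⊢
    rw [this]
    congr 1
    ring
  simp_rw [hpow]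
  set G := ∑ i ∈ Finset.range (h + 1), ω ^ i
  have hgeom : G * (ω - 1) = ω ^ (h + 1) - 1 := geom_sum_mul ω (h + 1)
  have hn := congrArg norm hgeom
  have h1 := hexp 1
  rw [pow_one] at h1
  rw [norm_mul, hexp (h + 1), h1, Complex.norm_exp_I_mul_ofReal_sub_one,
    Complex.norm_exp_I_mul_ofReal_sub_one] at hn
  set β : ℝ := Real.pi / (2 * p) with hβ
  have hβ0 : 0 < β := by positivity
  have hβ1 : β < Real.pi / 2 := by
    rw [hβ, div_lt_div_iff₀ (by positivity) (by positivity)]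
    nlinarith
  have e1 : 2 * Real.pi * ((1 : ℕ) : ℝ) / p / 2 = 2 * β := by
    rw [hβ]
    field_simp
    push_cast
    ring
  have e2 : 2 * Real.pi * ((h + 1 : ℕ) : ℝ) / p / 2 = β + Real.pi / 2 := by
    have : (p : ℝ) = 2 * h + 1 := by exact_mod_cast hp
    rw [hβ]
    push_cast
    field_simp
    rw [this]
    ring
  rw [e1, e2, Real.sin_two_mul, Real.sin_add_pi_div_two] at hn
  have hs : 0 < Real.sin β := Real.sin_pos_of_pos_of_lt_pi hβ0 (by linarith)
  have hc : 0 < Real.cos β := Real.cos_pos_of_mem_Ioo ⟨by linarith, hβ1⟩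
  rw [Real.norm_of_nonneg (by positivity), Real.norm_of_nonneg (by positivity)] at hn
  -- Here |ω ^ (h + 1) - 1| = 2 cos β and |ω - 1| = 4 sin β cos β.
  have h2 : ‖G‖ * (2 * Real.sin β) = 1 := by
    have : (‖G‖ * (2 * Real.sin β)) * (2 * Real.cos β) = 1 * (2 * Real.cos β) := by
      linear_combination hn
    exact mul_right_cancel₀ (by positivity) this
  have h3 : Real.sin β ≤ β := Real.sin_le hβ0.le
  have h4 : 1 ≤ ‖G‖ * (2 * β) := by
    rw [← h2]
    gcongr
  have h5 : ‖G‖ * (2 * β) = Real.pi * ‖G‖ / p := by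
    rw [hβ]
    field_simp
  rw [h5, le_div_iff₀ hp0] at h4
  linarith

/-- On the unit circle (Re z)² = 1/2 + Re(z²)/2, and the second harmonic sums to 0 for odd p. The
value p/2 instead of p saves a factor 2 in the Cauchy–Schwarz step of `exists_halfCircle`. -/
theorem sum_re_mul_stdAddChar_sq (hp2 : p ≠ 2) (c : ℂ) (hc : ‖c‖ = 1) :
    ∑ j : ZMod p, ((ZMod.stdAddChar j : ℂ) * c).re ^ 2 = (p : ℝ) / 2 := by
  have h2ne : (2 : ZMod p) ≠ 0 := by
    intro h
    have h2 : ((2 : ℕ) : ZMod p) = 0 := by exact_mod_cast h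
    rw [ZMod.natCast_eq_zero_iff] at h2
    exact hp2 ((Nat.prime_dvd_prime_iff_eq (Fact.out : p.Prime) Nat.prime_two).1 h2)
  have h1 : ∀ z : ℂ, ‖z‖ = 1 → z.re ^ 2 = 1 / 2 + (z ^ 2).re / 2 := by
    intro z hz
    have h3 : z.re ^ 2 + z.im ^ 2 = 1 := by
      have := Complex.sq_norm z
      rw [hz, Complex.normSq_apply] at this
      nlinarith
    have h4 : (z ^ 2).re = z.re ^ 2 - z.im ^ 2 := by
      rw [sq, Complex.mul_re]
      ring
    rw [h4]
    linarith
  have h5 : ∑ j : ZMod p, (((ZMod.stdAddChar j : ℂ) * c) ^ 2).re = 0 := by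
    rw [← Complex.re_sum]
    have : ∀ j : ZMod p, ((ZMod.stdAddChar j : ℂ) * c) ^ 2 = ZMod.stdAddChar (j * 2) * c ^ 2 := by
      intro j
      rw [mul_pow, sq (ZMod.stdAddChar j : ℂ), ← AddChar.map_add_eq_mul]
      congr 2
      ring
    simp_rw [this]
    rw [← Finset.sum_mul, sum_stdAddChar_mul, if_neg h2ne]
    simp
  rw [Finset.sum_congr rfl fun j _ => h1 _ (by rw [norm_mul, norm_stdAddChar, hc, one_mul]),
    Finset.sum_add_distrib, ← Finset.sum_div, ← Finset.sum_div, h5]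
  simp [ZMod.card]

/-- If the exponential sum of `X` at `r ≠ 0` is large, then some half circle contains much more
than half of `r X`. -/
theorem exists_halfCircle (X : Finset (ZMod p)) {r : ZMod p} (hr : r ≠ 0) {h : ℕ}
    (hp : p = 2 * h + 1) :
    ∃ (A : Finset ℤ) (u : ℤ), A ⊆ Finset.Icc u (u + h) ∧ affineImage 0 r⁻¹ A ⊆ X ∧
      X.card ≤ 2 * (affineImage 0 r⁻¹ A).card ∧
      8 * ‖expSum X r‖ ^ 2 ≤
        Real.pi ^ 2 * (2 * ((affineImage 0 r⁻¹ A).card : ℝ) - X.card) ^ 2 := by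
  classical
  have hprime := (Fact.out : p.Prime)
  have hp0 : (0 : ℝ) < p := by exact_mod_cast hprime.pos
  have hh : 1 ≤ h := by
    have := hprime.one_lt
    omega
  let f : ZMod p → ℕ := fun j => (X.filter (fun x => (r * x - j).val ≤ h)).card
  obtain ⟨j₀, -, hmax⟩ := Finset.exists_max_image (Finset.univ : Finset (ZMod p)) f
    ⟨0, Finset.mem_univ _⟩
  -- The half circles from j and from j + h + 1, with h + 1 points each, cover all 2h + 1 residues.
  -- So |2 f j - |X|| is at most its value at the maximum.
  have hcompl : ∀ j, X.card ≤ f j + f j₀ := by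
    intro j
    have h1 : X.card = f j + (X.filter (fun x => ¬ (r * x - j).val ≤ h)).card :=
      (Finset.card_filter_add_card_filter_not _).symm
    have h2 : (X.filter (fun x => ¬ (r * x - j).val ≤ h)).card ≤ f (j + (h + 1 : ℕ)) := by
      apply Finset.card_le_card
      intro x hx
      rw [Finset.mem_filter] at hx ⊢
      refine ⟨hx.1, ?_⟩
      have h3 : ((h + 1 : ℕ) : ZMod p).val = h + 1 := ZMod.val_cast_of_lt (by omega)
      have h4 : r * x - (j + (h + 1 : ℕ)) = (r * x - j) - ((h + 1 : ℕ) : ZMod p) := by ring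
      rw [h4, ZMod.val_sub (by omega), h3]
      have := ZMod.val_lt (r * x - j)
      omega
    have := hmax (j + (h + 1 : ℕ)) (Finset.mem_univ _)
    omega
  have hj₀ := hcompl j₀
  set A : Finset ℤ := (Finset.Icc (j₀.val : ℤ) (j₀.val + h)).filter
    (fun t : ℤ => r⁻¹ * (t : ZMod p) ∈ X) with hA
  have hAX : affineImage 0 r⁻¹ A ⊆ X := by
    intro x hx
    obtain ⟨t, ht, rfl⟩ := mem_affineImage.1 hx
    rw [zero_add]
    exact (Finset.mem_filter.1 ht).2
  have hfA : f j₀ ≤ (affineImage 0 r⁻¹ A).card := by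
    apply Finset.card_le_card
    intro x hx
    rw [Finset.mem_filter] at hx
    have hcast : ((((j₀.val + (r * x - j₀).val : ℕ) : ℤ)) : ZMod p) = r * x := by
      rw [Int.cast_natCast, Nat.cast_add, ZMod.natCast_zmod_val, ZMod.natCast_zmod_val]
      ring
    refine mem_affineImage.2 ⟨((j₀.val + (r * x - j₀).val : ℕ) : ℤ), ?_, ?_⟩
    · rw [hA, Finset.mem_filter, Finset.mem_Icc, hcast, inv_mul_cancel_left₀ hr]
      refine ⟨⟨by omega, by omega⟩, hx.1⟩
    · rw [hcast, inv_mul_cancel_left₀ hr, zero_add]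
  set W : ℂ := ∑ i ∈ Finset.range (h + 1), (ZMod.stdAddChar ((i : ℕ) : ZMod p) : ℂ) with hW
  have hconv : ∑ j : ZMod p, (f j : ℂ) * ZMod.stdAddChar j = expSum X r * (starRingEnd ℂ) W := by
    have h1 : ∀ j : ZMod p, (f j : ℂ) * ZMod.stdAddChar j =
        ∑ x ∈ X, if (r * x - j).val ≤ h then (ZMod.stdAddChar j : ℂ) else 0 := by
      intro j
      rw [← Finset.sum_filter, Finset.sum_const, nsmul_eq_mul]
    simp_rw [h1]
    rw [Finset.sum_comm, expSum, Finset.sum_mul]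
    refine Finset.sum_congr rfl fun x _ => ?_
    rw [hW, map_sum, Finset.mul_sum, ← Finset.sum_filter]
    refine (Finset.sum_bij (fun i _ => r * x - ((i : ℕ) : ZMod p)) ?_ ?_ ?_ ?_).symm
    · intro i hi
      rw [Finset.mem_range] at hi
      rw [Finset.mem_filter]
      refine ⟨Finset.mem_univ _, ?_⟩
      rw [sub_sub_cancel, ZMod.val_cast_of_lt (by omega)]
      omega
    · intro i hi i' hi' hii
      rw [Finset.mem_range] at hi hi'
      have := sub_right_injective hii
      rw [ZMod.natCast_eq_natCast_iff'] at this
      rwa [Nat.mod_eq_of_lt (by omega), Nat.mod_eq_of_lt (by omega)] at this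
    · intro j hj
      rw [Finset.mem_filter] at hj
      refine ⟨(r * x - j).val, Finset.mem_range.2 (by omega), ?_⟩
      rw [ZMod.natCast_zmod_val]
      ring
    · intro i _
      rw [star_stdAddChar, ← AddChar.map_add_eq_mul, sub_eq_add_neg]
  -- This allows f to be replaced by the centred function 2f - |X|.
  have hsum0 : ∑ j : ZMod p, (ZMod.stdAddChar j : ℂ) = 0 := by
    have := sum_stdAddChar_mul (p := p) 1
    simpa using this
  obtain ⟨φ, hφ⟩ := exists_exp_mul_eq_norm (expSum X r * (starRingEnd ℂ) W)
  set c : ℂ := Complex.exp (-(φ * Complex.I)) with hc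
  have hcn : ‖c‖ = 1 := by
    have : -((φ : ℂ) * Complex.I) = ((-φ : ℝ) : ℂ) * Complex.I := by push_cast; ring
    rw [hc, this, Complex.norm_exp_ofReal_mul_I]
  set n : ℝ := (X.card : ℝ) with hn
  have hre : ∑ j : ZMod p, (2 * (f j : ℝ) - n) * ((ZMod.stdAddChar j : ℂ) * c).re =
      2 * (‖expSum X r‖ * ‖W‖) := by
    have h1 : ∑ j : ZMod p, (2 * (f j : ℂ) - (n : ℂ)) * ((ZMod.stdAddChar j : ℂ) * c) =
        2 * ((‖expSum X r * (starRingEnd ℂ) W‖ : ℝ) : ℂ) := by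
      rw [← hφ, ← hconv]
      have h2 : ∀ j : ZMod p, (2 * (f j : ℂ) - (n : ℂ)) * ((ZMod.stdAddChar j : ℂ) * c) =
          2 * ((f j : ℂ) * ZMod.stdAddChar j) * c - (n : ℂ) * ZMod.stdAddChar j * c := by
        intro j
        ring
      simp_rw [h2]
      rw [Finset.sum_sub_distrib, ← Finset.sum_mul, ← Finset.sum_mul, ← Finset.mul_sum,
        ← Finset.mul_sum, hsum0]
      ring
    have h3 := congrArg Complex.re h1
    rw [Complex.re_sum, norm_mul, RCLike.norm_conj] at h3
    have h4 : ∀ j : ZMod p, ((2 * (f j : ℂ) - (n : ℂ)) * ((ZMod.stdAddChar j : ℂ) * c)).re =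
        (2 * (f j : ℝ) - n) * ((ZMod.stdAddChar j : ℂ) * c).re := by
      intro j
      have : (2 * (f j : ℂ) - (n : ℂ)) = ((2 * (f j : ℝ) - n : ℝ) : ℂ) := by push_cast; rfl
      rw [this, Complex.re_ofReal_mul]
    simp_rw [h4] at h3
    rw [h3]
    have : (2 : ℂ) * ((‖expSum X r‖ * ‖W‖ : ℝ) : ℂ) =
        ((2 * (‖expSum X r‖ * ‖W‖) : ℝ) : ℂ) := by push_cast; ring
    rw [this, Complex.ofReal_re]
  have hcs := Finset.sum_mul_sq_le_sq_mul_sq (Finset.univ : Finset (ZMod p))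
    (fun j => 2 * (f j : ℝ) - n) (fun j => ((ZMod.stdAddChar j : ℂ) * c).re)
  rw [hre, sum_re_mul_stdAddChar_sq (by omega) c hcn] at hcs
  set M : ℝ := ((affineImage 0 r⁻¹ A).card : ℝ) with hM
  have hsq : ∑ j : ZMod p, (2 * (f j : ℝ) - n) ^ 2 ≤ p * (2 * M - n) ^ 2 := by
    have h1 : ∀ j ∈ (Finset.univ : Finset (ZMod p)),
        (2 * (f j : ℝ) - n) ^ 2 ≤ (2 * M - n) ^ 2 := by
      intro j hj
      have e1 : (f j : ℝ) ≤ M := by rw [hM]; exact_mod_cast (hmax j hj).trans hfA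
      have e2 : n ≤ f j + M := by
        have := hcompl j
        rw [hM, hn]
        exact_mod_cast (show X.card ≤ f j + (affineImage 0 r⁻¹ A).card by omega)
      apply sq_le_sq'
      · linarith
      · linarith
    have := Finset.sum_le_card_nsmul _ _ _ h1
    rwa [Finset.card_univ, ZMod.card, nsmul_eq_mul] at this
  have hWp := le_norm_sum_halfCircle (p := p) hp
  rw [← hW] at hWp
  refine ⟨A, j₀.val, Finset.filter_subset _ _, hAX, by omega, ?_⟩
  have h1 : (2 * (‖expSum X r‖ * ‖W‖)) ^ 2 ≤ p * (2 * M - n) ^ 2 * (p / 2) :=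
    hcs.trans (mul_le_mul_of_nonneg_right hsq (by positivity))
  have h2 : (p : ℝ) ^ 2 ≤ (Real.pi * ‖W‖) ^ 2 := pow_le_pow_left₀ hp0.le hWp 2
  have h3 : 8 * ‖expSum X r‖ ^ 2 * (p : ℝ) ^ 2 ≤
      (Real.pi ^ 2 * (2 * M - n) ^ 2) * (p : ℝ) ^ 2 := by
    calc 8 * ‖expSum X r‖ ^ 2 * (p : ℝ) ^ 2
        ≤ 8 * ‖expSum X r‖ ^ 2 * (Real.pi * ‖W‖) ^ 2 :=
          mul_le_mul_of_nonneg_left h2 (by positivity)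
      _ = 2 * Real.pi ^ 2 * (2 * (‖expSum X r‖ * ‖W‖)) ^ 2 := by ring
      _ ≤ 2 * Real.pi ^ 2 * (p * (2 * M - n) ^ 2 * (p / 2)) :=
          mul_le_mul_of_nonneg_left h1 (by positivity)
      _ = _ := by ring
  exact le_of_mul_le_mul_right h3 (by positivity)

end Fourier

/-! ### Rectification of very small sets by pigeonhole. -/

section Dirichlet

variable {p : ℕ} [Fact p.Prime]

/-- A set `S` with `4 ^ |S| < p` has a dilate contained in a half circle. -/
theorem exists_halfCircle_of_pow_lt (S : Finset (ZMod p)) (hp : 4 ^ S.card < p) :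
    ∃ (r : ZMod p) (A : Finset ℤ) (u w : ℤ), r ≠ 0 ∧ A ⊆ Finset.Icc u (u + w) ∧ 2 * w < p ∧
      S = affineImage 0 r⁻¹ A := by
  classical
  have hprime := (Fact.out : p.Prime)
  -- F records the quarter of the circle containing each r s. Two multipliers with equal records
  -- differ by an r that brings every r s within p/4 of 0.
  let F : ZMod p → (S → Fin 4) := fun r s =>
    ⟨4 * (r * (s : ZMod p)).val / p, by
      have := ZMod.val_lt (r * (s : ZMod p))
      rw [Nat.div_lt_iff_lt_mul hprime.pos]
      omega⟩
  obtain ⟨r₁, r₂, hne, heq⟩ := Fintype.exists_ne_map_eq_of_card_lt F (by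
    rw [Fintype.card_fun, Fintype.card_fin, Fintype.card_coe, ZMod.card]
    exact hp)
  have hr : r₁ - r₂ ≠ 0 := sub_ne_zero.2 hne
  set w : ℤ := (p : ℤ) / 4 with hw
  have hw4 : 4 * w < p := by
    have h1 : 4 * w ≤ p := by omega
    refine lt_of_le_of_ne h1 fun h => ?_
    have h4 : 4 ∣ p := by
      have : (4 : ℤ) ∣ p := ⟨w, h.symm⟩
      exact_mod_cast this
    have h2 : 2 ∣ p := dvd_trans (by norm_num) h4
    have := (Nat.prime_dvd_prime_iff_eq Nat.prime_two hprime).1 h2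
    omega
  set A : Finset ℤ := (Finset.Icc (-w) (-w + 2 * w)).filter
    (fun t : ℤ => (r₁ - r₂)⁻¹ * (t : ZMod p) ∈ S) with hA
  refine ⟨r₁ - r₂, A, -w, 2 * w, hr, Finset.filter_subset _ _, by omega, ?_⟩
  ext x
  rw [mem_affineImage]
  constructor
  · intro hx
    have hcast : (((r₁ * x).val - (r₂ * x).val : ℤ) : ZMod p) = (r₁ - r₂) * x := by
      push_cast
      rw [ZMod.natCast_zmod_val, ZMod.natCast_zmod_val]
      ring
    refine ⟨(r₁ * x).val - (r₂ * x).val, ?_, ?_⟩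
    · rw [hA, Finset.mem_filter, Finset.mem_Icc, hcast, inv_mul_cancel_left₀ hr]
      refine ⟨?_, hx⟩
      have h1 := congrArg Fin.val (congrFun heq ⟨x, hx⟩)
      simp only [F] at h1
      have e1 := Nat.div_add_mod (4 * (r₁ * x).val) p
      have e2 := Nat.div_add_mod (4 * (r₂ * x).val) p
      have e3 := Nat.mod_lt (4 * (r₁ * x).val) hprime.pos
      have e4 := Nat.mod_lt (4 * (r₂ * x).val) hprime.pos
      rw [h1] at e1
      generalize p * (4 * (r₂ * x).val / p) = q at e1 e2
      omega
    · rw [hcast, inv_mul_cancel_left₀ hr, zero_add]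
  · rintro ⟨t, ht, rfl⟩
    rw [zero_add]
    exact (Finset.mem_filter.1 ht).2

end Dirichlet

/-! ### The four ranges of |S|. -/

section SmallDoubling

variable {p : ℕ} [Fact p.Prime]

/-- `S` is contained in a progression with at most `t + 1` terms. -/
def IsCoveredByProgression (S : Finset (ZMod p)) (t : ℕ) : Prop :=
  ∃ (a e : ZMod p) (s : ℕ), e ≠ 0 ∧ s ≤ t ∧ ∀ b ∈ S, ∃ i : ℕ, i ≤ s ∧ b = a + (i : ZMod p) * e

theorem isCoveredByProgression_affineImage {c d : ZMod p} (hd : d ≠ 0) {A : Finset ℤ} {l t : ℕ}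
    (hA : IsNormalized A l) (hl : l ≤ t) : IsCoveredByProgression (affineImage c d A) t := by
  refine ⟨c, d, l, hd, hl, ?_⟩
  intro b hb
  obtain ⟨z, hz, rfl⟩ := mem_affineImage.1 hb
  have h1 := Finset.mem_Icc.1 (hA.subset hz)
  obtain ⟨i, rfl⟩ := Int.eq_ofNat_of_zero_le h1.1
  refine ⟨i, ?_, ?_⟩
  · have := h1.2
    omega
  · simp [mul_comm]

/-- The pigeonhole argument needs 4 ^ |S| < p; 4 ^ 47 = 2 ^ 94 is the origin of p₀. -/
theorem isCoveredByProgression_of_card_le (S : Finset (ZMod p)) (hn : S.card ≤ 47)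
    (hp : 2 ^ 94 < p) (h1 : (S + S).card ≤ 2 * S.card) (h2 : (S + S).card + 4 ≤ 3 * S.card) :
    IsCoveredByProgression S ((S + S).card - S.card) := by
  have hpow : 4 ^ S.card < p := by
    calc 4 ^ S.card ≤ 4 ^ 47 := Nat.pow_le_pow_right (by norm_num) hn
      _ = 2 ^ 94 := by norm_num
      _ < p := hp
  obtain ⟨r, A, u, w, hr, hA, hw, hS⟩ := exists_halfCircle_of_pow_lt S hpow
  obtain ⟨c, d, l, A', hd, hA', hSA, hl⟩ := exists_isNormalized_of_card_add_self
    (subset_refl S) (inv_ne_zero hr) hS hA hw (by omega) (by omega) (by norm_num at hp; omega)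
  have := isCoveredByProgression_affineImage (c := c) hd hA' (t := (S + S).card - S.card) (by omega)
  rwa [← hSA] at this

/-- The energy bound is nearly |S|²/2, because |2S| is near 2|S| and both are small against p. A
half circle then holds 81.7% of S, so 5|S'| exceeds 2|2S| by about 0.087|S|, and |S| ≥ 48 absorbs
the additive 4. -/
theorem isCoveredByProgression_of_sparse (S : Finset (ZMod p)) (hp2 : p ≠ 2)
    (hn : 48 ≤ S.card) (hnp : 200 * S.card ≤ p) (h1 : 10000 * (S + S).card ≤ 20001 * S.card) :
    IsCoveredByProgression S ((S + S).card - S.card) := by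
  classical
  have hprime := (Fact.out : p.Prime)
  have hS : S.Nonempty := Finset.card_pos.1 (by omega)
  have hodd : p % 2 = 1 := by
    rcases hprime.eq_two_or_odd with h | h
    · exact absurd h hp2
    · exact h
  obtain ⟨h, hh⟩ : ∃ h, p = 2 * h + 1 := ⟨p / 2, by omega⟩
  have hYc : ((S + S)ᶜ).card = p - (S + S).card := by rw [Finset.card_compl, ZMod.card]
  have hYne : ((S + S)ᶜ).Nonempty := Finset.card_pos.1 (by omega)
  obtain ⟨r, hr, hF⟩ := exists_expSum_ge S S ((S + S)ᶜ)
    (fun x hx s hs => by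
      rw [Finset.mem_compl, not_not]
      exact Finset.add_mem_add hx hs) hS hYne
  obtain ⟨A, u, hA, hAS, hM, hhalf⟩ := exists_halfCircle S hr hh
  set S' := affineImage 0 r⁻¹ A with hS'
  rw [hYc, Nat.cast_sub (by omega)] at hF
  set T := ‖expSum S r‖
  have hSS : S.card ≤ (S + S).card := Finset.card_le_card_add_left hS
  have e1 : (10000 * (S + S).card : ℝ) ≤ 20001 * S.card := by exact_mod_cast h1
  have e2 : (200 * S.card : ℝ) ≤ p := by exact_mod_cast hnp
  have e3 : (48 : ℝ) ≤ S.card := by exact_mod_cast hn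
  have e4 : (S.card : ℝ) ≤ 2 * S'.card := by exact_mod_cast hM
  have e5 : (S.card : ℝ) ≤ (S + S).card := by exact_mod_cast hSS
  set n : ℝ := (S.card : ℝ)
  set N : ℝ := ((S + S).card : ℝ)
  set M : ℝ := (S'.card : ℝ)
  have hT : 0.4974 * n ^ 2 ≤ T ^ 2 := by
    have f1 : 0.4974 * ((p - n) * N) ≤ n * (p - N) := by nlinarith
    have f2 : (0.4974 * n ^ 2) * ((p - n) * N) ≤ T ^ 2 * ((p - n) * N) := by
      calc (0.4974 * n ^ 2) * ((p - n) * N) = n ^ 2 * (0.4974 * ((p - n) * N)) := by ring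
        _ ≤ n ^ 2 * (n * (p - N)) := mul_le_mul_of_nonneg_left f1 (by positivity)
        _ ≤ T ^ 2 * ((p - n) * (p - (p - N))) := hF
        _ = _ := by ring
    exact le_of_mul_le_mul_right f2 (mul_pos (by linarith) (by linarith))
  have hpi2 : Real.pi ^ 2 ≤ 9.8697 := by
    have := Real.pi_lt_d4
    have := Real.pi_pos
    nlinarith
  have hMn : 0.6349 * n ≤ 2 * M - n := by
    have g1 : 8 * (0.4974 * n ^ 2) ≤ 9.8697 * (2 * M - n) ^ 2 := by
      calc 8 * (0.4974 * n ^ 2) ≤ 8 * T ^ 2 := by linarith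
        _ ≤ _ := hhalf
        _ ≤ _ := mul_le_mul_of_nonneg_right hpi2 (by positivity)
    refine le_of_sq_le_sq ?_ (by linarith)
    nlinarith
  have g2 : 2 * (S + S).card + 4 ≤ 5 * S'.card := by
    have : (2 * (S + S).card + 4 : ℝ) ≤ 5 * S'.card := by linarith
    exact_mod_cast this
  have g3 : 6 * (S + S).card < p + 6 * S'.card := by
    have : (6 * (S + S).card : ℝ) < p + 6 * S'.card := by linarith
    exact_mod_cast this
  obtain ⟨c, d, l, A', hd, hA', hSA, hl⟩ := exists_isNormalized_of_card_add_self
    hAS (inv_ne_zero hr) hS' hA (by omega) (by omega) g2 g3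
  have := isCoveredByProgression_affineImage (c := c) hd hA' (t := (S + S).card - S.card) (by omega)
  rwa [← hSA] at this

/-- K = 1 + g/n is the ratio needed in `card_iterSum_le_of_card_add_le`; it yields |6X| ≤ 6.04g + 1
and |4X| ≤ 4.02g + 1. -/
theorem exists_ratio_of_le_small {n g : ℝ} (hn : 0 < n) (hg : 0 ≤ g) (h : g ≤ 0.002 * n) :
    ∃ K : ℝ, 1 ≤ K ∧ K * n = n + g ∧ K ^ 6 * n ≤ n + 6.04 * g ∧ K ^ 4 * n ≤ n + 4.02 * g := by
  obtain ⟨z, hz⟩ : ∃ z, z = g / n := ⟨_, rfl⟩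
  have hz0 : 0 ≤ z := hz ▸ by positivity
  have hz1 : z ≤ 0.002 := by rwa [hz, div_le_iff₀ hn]
  have hzn : g = z * n := by rw [hz, div_mul_cancel₀ _ hn.ne']
  have step : ∀ j : ℕ, z ^ (j + 1) * z ≤ 0.002 * z ^ (j + 1) := fun j => by
    rw [mul_comm]
    exact mul_le_mul_of_nonneg_right hz1 (by positivity)
  have h1 := step 0
  have h2 := step 1
  have h3 := step 2
  have h4 := step 3
  have h5 := step 4
  simp only [zero_add, Nat.reduceAdd, ← pow_succ] at h1 h2 h3 h4 h5
  rw [pow_one] at h1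
  have k6 : (1 + z) ^ 6 ≤ 1 + 6.04 * z := by
    have : (1 + z) ^ 6 = 1 + 6 * z + 15 * z ^ 2 + 20 * z ^ 3 + 15 * z ^ 4 + 6 * z ^ 5 + z ^ 6 := by
      ring
    linarith
  have k4 : (1 + z) ^ 4 ≤ 1 + 4.02 * z := by
    have : (1 + z) ^ 4 = 1 + 4 * z + 6 * z ^ 2 + 4 * z ^ 3 + z ^ 4 := by ring
    linarith
  refine ⟨1 + z, by linarith, by rw [hzn]; ring, ?_, ?_⟩
  · have := mul_le_mul_of_nonneg_right k6 hn.le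
    rw [hzn]
    linarith
  · have := mul_le_mul_of_nonneg_right k4 hn.le
    rw [hzn]
    linarith

theorem exists_ratio_of_le {n g c : ℝ} (hn : 0 < n) (hg : 0 ≤ g) (h : g ≤ c * n) :
    ∃ K : ℝ, 1 ≤ K ∧ K * n = n + g ∧ K ^ 2 * n ≤ n + (2 + c) * g := by
  obtain ⟨z, hz⟩ : ∃ z, z = g / n := ⟨_, rfl⟩
  have hz0 : 0 ≤ z := hz ▸ by positivity
  have hz1 : z ≤ c := by rwa [hz, div_le_iff₀ hn]
  have hzn : g = z * n := by rw [hz, div_mul_cancel₀ _ hn.ne']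
  refine ⟨1 + z, by linarith, by rw [hzn]; ring, ?_⟩
  have := mul_le_mul_of_nonneg_right hz1 hg
  have e : (1 + z) ^ 2 * n = n + 2 * (z * n) + z * (z * n) := by ring
  rw [e, ← hzn]
  linarith

theorem le_of_energy_bound_small {P n k g T : ℝ} (hn : 0 < n) (hk : 0 < k) (hT : 0 ≤ T)
    (hP : P = 2 * n + g) (hg : 0 ≤ g) (hgk : g ≤ 2 * k) (hkn : 1000 * k ≤ n)
    (hF : k ^ 2 * (n * n) ≤ T ^ 2 * ((P - n) * (P - n))) : 0.998 * k ≤ T := by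
  have f1 : (k * n) ^ 2 ≤ (T * (P - n)) ^ 2 := by
    rw [mul_pow, mul_pow, sq n, sq (P - n)]
    exact hF
  have f2 : k * n ≤ T * (P - n) :=
    (pow_le_pow_iff_left₀ (by positivity) (mul_nonneg hT (by linarith)) two_ne_zero).1 f1
  have f3 : T * (P - n) ≤ T * (1.002 * n) := mul_le_mul_of_nonneg_left (by linarith) hT
  have f4 : k * n ≤ (1.002 * T) * n := by linarith
  have f5 := le_of_mul_le_mul_right f4 hn
  linarith

theorem le_of_energy_bound_large {P n G x T : ℝ} (hn : 0 < n) (hT : 0 ≤ T) (hx : 0 ≤ x)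
    (hP : 2 * n ≤ P) (hnG : n ≤ G) (hG : G ≤ 1.0363 * n)
    (hF : x ^ 2 * (n * (P - G)) ≤ T ^ 2 * ((P - n) * G)) : 0.964 * x ≤ T := by
  have f1 : 0.9296 * ((P - n) * G) ≤ n * (P - G) := by
    have k1 : 0.9649 * G ≤ n := by linarith
    have k2 : 0.9637 * (P - n) ≤ P - G := by linarith
    have k3 : 0 ≤ P - n := by linarith
    have k4 : (0.9649 * G) * (0.9637 * (P - n)) ≤ n * (P - G) :=
      mul_le_mul k1 k2 (by positivity) (by linarith)
    have k5 : 0 ≤ (P - n) * G := mul_nonneg k3 (by linarith)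
    linarith
  have f2 : (0.9296 * x ^ 2) * ((P - n) * G) ≤ T ^ 2 * ((P - n) * G) := by
    calc (0.9296 * x ^ 2) * ((P - n) * G) = x ^ 2 * (0.9296 * ((P - n) * G)) := by ring
      _ ≤ x ^ 2 * (n * (P - G)) := mul_le_mul_of_nonneg_left f1 (by positivity)
      _ ≤ _ := hF
  have f3 := le_of_mul_le_mul_right f2 (mul_pos (by linarith) (by linarith))
  refine (pow_le_pow_iff_left₀ (by positivity) hT two_ne_zero).1 (le_trans ?_ f3)
  rw [mul_pow]
  exact mul_le_mul_of_nonneg_right (by norm_num) (by positivity)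

/-- To be read with x = |X|, D = |X - X|, G = |X + S|. Eliminating D gives 1000(x² - x) ≤ G². If x >
0.033n, then G ≤ 31.32x, and 31.32² < 1000. -/
theorem le_of_difference_bound {n G x q D : ℝ} (hx : 1000000 ≤ x) (hD : 0 ≤ D)
    (hq : 1000 * q ≤ n) (hG : G ≤ 1.0001 * n + x) (hG0 : 0 ≤ G)
    (h1 : x * x ≤ x + D * q) (h2 : D * n ≤ G * G) : x ≤ 0.033 * n := by
  by_contra! hcon
  have f1 : 1000 * (x * x - x) ≤ G * G := by
    have : D * (1000 * q) ≤ D * n := mul_le_mul_of_nonneg_left hq hD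
    linarith
  have f2 : G ≤ 31.32 * x := by linarith
  have f3 : G * G ≤ (31.32 * x) * (31.32 * x) := mul_le_mul f2 f2 hG0 (by linarith)
  have f4 : 1000000 * x ≤ x * x := mul_le_mul_of_nonneg_right hx (by linarith)
  linarith

/-- X = -(2S)ᶜ has k elements and |X + S| ≤ |S| + g with g = p - 2|S| < 2k. This bounds |2X| only by
about 4k, too weak for the 5/2 criterion, but |6X| stays near 12k, below the 12.4 threshold of
`IsNormalized.length_le_of_card_iterSum_six`. -/
theorem isCoveredByProgression_of_card_compl_small (S : Finset (ZMod p)) (hp2 : 6 < p)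
    (h1 : 2 * S.card ≤ (S + S).card + 1) (h2 : 2 * (S + S).card + 3 ≤ p + 2 * S.card)
    (h3 : 1000 * (p - (S + S).card) < S.card) :
    IsCoveredByProgression S ((S + S).card - S.card) := by
  classical
  have hprime := (Fact.out : p.Prime)
  have hS : S.Nonempty := Finset.card_pos.1 (by omega)
  set X : Finset (ZMod p) := -((S + S)ᶜ) with hX
  have hXc : X.card = p - (S + S).card := by
    rw [hX, Finset.card_neg, Finset.card_compl, ZMod.card]
  have hXS : ∀ x ∈ X, ∀ s ∈ S, x + s ∉ -S := by
    intro x hx s hs h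
    rw [hX, Finset.mem_neg', Finset.mem_compl] at hx
    rw [Finset.mem_neg'] at h
    apply hx
    convert Finset.add_mem_add hs h using 1
    ring
  have hXSc : (X + S).card ≤ p - S.card := by
    have : X + S ⊆ (-S)ᶜ := by
      intro y hy
      obtain ⟨x, hx, s, hs, rfl⟩ := Finset.mem_add.1 hy
      exact Finset.mem_compl.2 (hXS x hx s hs)
    have := Finset.card_le_card this
    rwa [Finset.card_compl, Finset.card_neg, ZMod.card] at this
  set k := p - (S + S).card with hk
  have hk2 : 2 ≤ k := by omega
  have hXne : X.Nonempty := Finset.card_pos.1 (by omega)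
  -- This is where m ≤ p - |2S| - 3 enters.
  have hg : p - 2 * S.card + 3 ≤ 2 * k := by omega
  obtain ⟨r, hr, hF⟩ := exists_expSum_ge X S (-S) hXS hS hS.neg
  rw [hXc, Finset.card_neg] at hF
  have hpi := Real.pi_pos
  -- An arc of half-angle π/6 has length p/6, so sixfold sums do not wrap around.
  obtain ⟨A, u, w, hA, hw, hAX, harc⟩ := exists_arc X hr (α := Real.pi / 6) (by positivity)
    (by linarith)
  set X' := affineImage 0 r⁻¹ A with hX'
  rw [hXc, Real.cos_pi_div_six] at harc
  set T := ‖expSum X r‖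
  have hT0 : 0 ≤ T := norm_nonneg _
  have hw6 : 6 * w < p := by
    have e1 : (6 * w : ℝ) ≤ p := by
      have : Real.pi * (6 * w) ≤ Real.pi * p := by linarith
      exact le_of_mul_le_mul_left this hpi
    have e2 : 6 * w ≤ p := by exact_mod_cast e1
    refine lt_of_le_of_ne e2 fun h => ?_
    have h6 : 6 ∣ p := by
      have : (6 : ℤ) ∣ p := ⟨w, h.symm⟩
      exact_mod_cast this
    have h2 : 2 ∣ p := dvd_trans (by norm_num) h6
    have := (Nat.prime_dvd_prime_iff_eq Nat.prime_two hprime).1 h2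
    omega
  obtain ⟨g, hgdef⟩ : ∃ g, p = 2 * S.card + g := ⟨p - 2 * S.card, by omega⟩
  have e1 : (p : ℝ) = 2 * S.card + g := by exact_mod_cast hgdef
  have e2 : (g : ℝ) + 3 ≤ 2 * k := by
    have : g + 3 ≤ 2 * k := by omega
    exact_mod_cast this
  have e3 : (1000 * k : ℝ) ≤ S.card := by exact_mod_cast h3.le
  have e4 : (2 : ℝ) ≤ k := by exact_mod_cast hk2
  have eg : (0 : ℝ) ≤ g := by positivity
  have hn0 : (0 : ℝ) < S.card := by linarith
  have hT : 0.998 * (k : ℝ) ≤ T :=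
    le_of_energy_bound_small hn0 (by linarith) hT0 e1 eg (by linarith) e3 (by
      refine hF.trans (le_of_eq ?_)
      ring)
  have hX'c : X'.card ≤ k := by
    rw [← hXc]
    exact Finset.card_le_card hAX
  have ha : 0.985 * (k : ℝ) ≤ X'.card := by
    have f1 : √3 / 2 ≤ 0.8661 := by
      have : √3 ≤ 1.7322 := by
        rw [Real.sqrt_le_left (by norm_num)]
        norm_num
      linarith
    have f2 : (0 : ℝ) ≤ k - X'.card := by
      have : (X'.card : ℝ) ≤ k := by exact_mod_cast hX'c
      linarith
    have f3 := mul_le_mul_of_nonneg_left f1 f2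
    linarith
  obtain ⟨K, hK1, hKn, hK6, hK4⟩ := exists_ratio_of_le_small hn0 eg (by linarith)
  have hK : ((X + S).card : ℝ) ≤ K * S.card := by
    have : (X + S).card ≤ S.card + g := by omega
    rw [hKn]
    exact_mod_cast this
  have hc6 := card_iterSum_le_of_card_add_le X S hXne hS hK1 hK 6 (by linarith)
  have hc4 := card_iterSum_le_of_card_add_le X S hXne hS hK1 hK 4 (by linarith)
  have hc6' : ((iterSum X 6).card : ℝ) ≤ 6.04 * g + 1 := by linarith
  have hc4' : ((iterSum X 4).card : ℝ) ≤ 4.02 * g + 1 := by linarith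
  have q6 : 10 * (iterSum X 6).card + 114 < 124 * X'.card := by
    have : (10 * (iterSum X 6).card + 114 : ℝ) < 124 * X'.card := by linarith
    exact_mod_cast this
  have q4 : (iterSum X 4).card + 6 < 9 * X'.card := by
    have : ((iterSum X 4).card + 6 : ℝ) < 9 * X'.card := by linarith
    exact_mod_cast this
  have q2 : 2 ≤ X'.card := by
    have : (1 : ℝ) < X'.card := by linarith
    exact_mod_cast this
  obtain ⟨c, d, l, A', hd, hA', hXA, hl⟩ := exists_isNormalized_of_card_iterSum (by omega)
    hAX (inv_ne_zero hr) hX' hA hw6 q2 q6 q4 (by omega)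
  have hcard : X.card = A'.card := by
    conv_lhs => rw [hXA]
    exact card_affineImage (u := 0) (w := l) hd (by simpa using hA'.subset)
      (by exact_mod_cast (show l < p by omega))
  have hwin : HasWindowGain A' l 7 ((13 * (k - 1) + 99) / 100) :=
    hA'.hasWindowGain_of_sparse (by omega) (by omega)
  -- 16 · 0.13 = 2.08 beats g ≤ 2k - 3, and the windows take up 16 · 9 · 2.7k < 389k < |S|.
  obtain ⟨a, e, s, he, hs, hcov⟩ := exists_progression_of_hasWindowGain (M := 16) (g := g) (S := S)
    hA' hwin hd hXA (by omega) (by omega) (by omega) (by omega) (by omega) (by omega)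
  exact ⟨a, e, s, he, by omega, hcov⟩

/-- The number of pairs with a given difference is at most the overlap with a translate. -/
theorem card_sq_le_of_card_inter_vadd_lt {G : Type*} [AddCommGroup G] [DecidableEq G]
    (X : Finset G) {q : ℕ} (h : ∀ t : G, t ≠ 0 → (X ∩ (t +ᵥ X)).card < q + 1) :
    X.card * X.card ≤ X.card + (X - X).card * q := by
  classical
  have hmaps : ∀ z ∈ X ×ˢ X, z.1 - z.2 ∈ X - X := by
    intro z hz
    rw [Finset.mem_product] at hz
    exact Finset.sub_mem_sub hz.1 hz.2
  have hfib : ∀ t ∈ X - X, ((X ×ˢ X).filter (fun z => z.1 - z.2 = t)).card ≤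
      q + if t = 0 then X.card else 0 := by
    intro t _
    have h1 : ((X ×ˢ X).filter (fun z => z.1 - z.2 = t)).card ≤ (X ∩ (t +ᵥ X)).card := by
      apply Finset.card_le_card_of_injOn Prod.fst
      · intro z hz
        rw [Finset.mem_coe, Finset.mem_filter, Finset.mem_product] at hz
        rw [Finset.mem_coe, Finset.mem_inter, Finset.mem_vadd_finset]
        refine ⟨hz.1.1, z.2, hz.1.2, ?_⟩
        rw [vadd_eq_add, ← hz.2]
        abel
      · intro z hz z' hz' hzz
        rw [Finset.mem_coe, Finset.mem_filter] at hz hz'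
        refine Prod.ext hzz ?_
        have := hz.2.trans hz'.2.symm
        rw [hzz] at this
        exact sub_right_injective this
    split_ifs with ht
    · subst ht
      have : (X ∩ ((0 : G) +ᵥ X)).card ≤ X.card := Finset.card_le_card Finset.inter_subset_left
      omega
    · have := h t ht
      omega
  have h1 := Finset.card_eq_sum_card_fiberwise hmaps
  rw [Finset.card_product] at h1
  rw [h1]
  refine (Finset.sum_le_sum hfib).trans ?_
  rw [Finset.sum_add_distrib, Finset.sum_const, smul_eq_mul, Finset.sum_ite_eq']
  split_ifs <;> omega

/-- X is an atom of S at level about |S|/1000. Minimality against S itself gives g = m + |X|, and m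
≤ |S|/10⁴ ≤ |X|/10, so g ≤ 1.1|X|. The small overlaps of X with its translates make |X - X| large,
while Ruzsa's inequality bounds it above; hence |X| ≤ 0.033|S|. -/
theorem isCoveredByProgression_of_card_compl_large (S : Finset (ZMod p))
    (hn : 10 ^ 9 ≤ S.card) (h0 : 10000 * (S + S).card ≤ 20001 * S.card)
    (h1 : 2 * S.card ≤ (S + S).card + 1) (h2 : 2 * (S + S).card + 3 ≤ p + 2 * S.card)
    (h3 : S.card ≤ 1000 * (p - (S + S).card)) :
    IsCoveredByProgression S ((S + S).card - S.card) := by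
  classical
  have hprime := (Fact.out : p.Prime)
  have hS : S.Nonempty := Finset.card_pos.1 (by omega)
  set q := (S.card - 1) / 1000 with hq
  have hq1 : 1000 * q < S.card := by omega
  have hq2 : S.card ≤ 1000 * (q + 1) := by omega
  obtain ⟨X, hX1, hX2, hmin, htr⟩ := exists_isoperimetric_atom S (q + 1)
    ⟨S, by omega, by rw [ZMod.card]; omega⟩
  rw [ZMod.card] at hX2
  have hG := hmin S (by omega) (by rw [ZMod.card]; omega)
  have hXne : X.Nonempty := Finset.card_pos.1 (by omega)
  have hXle : X.card ≤ (X + S).card := Finset.card_le_card_add_right hS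
  -- A nonzero t cannot stabilise X: by Cauchy–Davenport {0, t} + X is larger than X.
  have hinter : ∀ t : ZMod p, t ≠ 0 → (X ∩ (t +ᵥ X)).card < q + 1 := by
    intro t ht
    rcases htr t with h | h
    · exfalso
      have hcd := ZMod.cauchy_davenport hprime (s := {0, t}) (t := X) ⟨0, by simp⟩ hXne
      have hsub : ({0, t} : Finset (ZMod p)) + X ⊆ X := by
        intro y hy
        obtain ⟨t', ht', x, hx, rfl⟩ := Finset.mem_add.1 hy
        rw [Finset.mem_insert, Finset.mem_singleton] at ht'
        rcases ht' with rfl | rfl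
        · rwa [zero_add]
        · rw [← h]
          exact Finset.vadd_mem_vadd_finset hx
      have hc := Finset.card_le_card hsub
      rw [Finset.card_pair (Ne.symm ht)] at hcd
      rcases min_le_iff.1 hcd with h | h <;> omega
    · exact h
  have hsq := card_sq_le_of_card_inter_vadd_lt X hinter
  have hruz := Finset.ruzsa_triangle_inequality_sub_add_add X S X
  obtain ⟨g, hg⟩ : ∃ g, g + 2 * S.card = (S + S).card + X.card :=
    ⟨(S + S).card + X.card - 2 * S.card, by omega⟩
  have hGg : (X + S).card ≤ S.card + g := by omega
  have e0 : (10000 * (S + S).card : ℝ) ≤ 20001 * S.card := by exact_mod_cast h0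
  have e1 : (2 * S.card : ℝ) ≤ (S + S).card + 1 := by exact_mod_cast h1
  have e2 : (2 * (S + S).card : ℝ) + 3 ≤ p + 2 * S.card := by exact_mod_cast h2
  have e3 : (S.card : ℝ) ≤ 1000 * X.card := by
    have : S.card ≤ 1000 * X.card := by omega
    exact_mod_cast this
  have e4 : (g : ℝ) + 2 * S.card = (S + S).card + X.card := by exact_mod_cast hg
  have e5 : ((X + S).card : ℝ) ≤ S.card + g := by exact_mod_cast hGg
  have e6 : (10 ^ 9 : ℝ) ≤ S.card := by exact_mod_cast hn
  have e7 : (1000 * q : ℝ) ≤ S.card := by exact_mod_cast hq1.le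
  have e8 : (X.card : ℝ) * X.card ≤ X.card + (X - X).card * q := by exact_mod_cast hsq
  have e9 : ((X - X).card : ℝ) * S.card ≤ (X + S).card * (X + S).card := by exact_mod_cast hruz
  have e10 : (2 * S.card : ℝ) ≤ p := by
    have : 2 * S.card ≤ p := by omega
    exact_mod_cast this
  have hYc : ((X + S)ᶜ).card = p - (X + S).card := by rw [Finset.card_compl, ZMod.card]
  have hYne : ((X + S)ᶜ).Nonempty := Finset.card_pos.1 (by omega)
  obtain ⟨r, hr, hF⟩ := exists_expSum_ge X S ((X + S)ᶜ)
    (fun x hx s hs => by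
      rw [Finset.mem_compl, not_not]
      exact Finset.add_mem_add hx hs) hS hYne
  rw [hYc, Nat.cast_sub (by omega)] at hF
  have hpi := Real.pi_pos
  obtain ⟨A, u, w, hA, hw, hAX, harc⟩ := exists_arc X hr (α := Real.pi / 2) (by positivity)
    (by linarith)
  set X' := affineImage 0 r⁻¹ A with hX'
  rw [Real.cos_pi_div_two, mul_zero, add_zero] at harc
  set T := ‖expSum X r‖
  have hT0 : 0 ≤ T := norm_nonneg _
  have hw2 : 2 * w < p := by
    have f1 : (2 * w : ℝ) ≤ p := by
      have : Real.pi * (2 * w) ≤ Real.pi * p := by linarith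
      exact le_of_mul_le_mul_left this hpi
    have f2 : 2 * w ≤ p := by exact_mod_cast f1
    refine lt_of_le_of_ne f2 fun h => ?_
    have h2 : 2 ∣ p := by
      have : (2 : ℤ) ∣ p := ⟨w, h.symm⟩
      exact_mod_cast this
    have := (Nat.prime_dvd_prime_iff_eq Nat.prime_two hprime).1 h2
    omega
  have hGn : (S.card : ℝ) ≤ (X + S).card := by
    exact_mod_cast Finset.card_le_card_add_left hXne
  have hn0 : (0 : ℝ) < S.card := by linarith
  have hgx : (g : ℝ) ≤ 1.1 * X.card := by linarith
  have hxn : (X.card : ℝ) ≤ 0.033 * S.card :=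
    le_of_difference_bound (by linarith) (Nat.cast_nonneg _) e7 (by linarith) (Nat.cast_nonneg _)
      e8 e9
  have hgn : (g : ℝ) ≤ 0.0363 * S.card := by linarith
  have hT : 0.964 * (X.card : ℝ) ≤ T :=
    le_of_energy_bound_large hn0 hT0 (Nat.cast_nonneg _) e10 hGn (by linarith) (by
      refine hF.trans (le_of_eq ?_)
      ring)
  have ha : 0.964 * (X.card : ℝ) ≤ X'.card := hT.trans harc
  obtain ⟨K, hK1, hKn, hK2⟩ := exists_ratio_of_le hn0 (Nat.cast_nonneg _) hgn
  have hc2 := card_iterSum_le_of_card_add_le X S hXne hS hK1 (by rw [hKn]; exact e5) 2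
    (by linarith)
  rw [iterSum_two] at hc2
  have hc2' : ((X + X).card : ℝ) ≤ 2.0363 * g + 1 := by linarith
  have q2 : 2 ≤ X'.card := by
    have : (2 : ℝ) ≤ X'.card := by linarith
    exact_mod_cast this
  have q5 : 2 * (X + X).card + 4 ≤ 5 * X'.card := by
    have : (2 * (X + X).card + 4 : ℝ) ≤ 5 * X'.card := by linarith
    exact_mod_cast this
  have q6 : 6 * (X + X).card < p + 6 * X'.card := by
    have : (6 * (X + X).card : ℝ) < p + 6 * X'.card := by linarith
    exact_mod_cast this
  obtain ⟨c, d, l, A', hd, hA', hXA, hl⟩ := exists_isNormalized_of_card_add_self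
    hAX (inv_ne_zero hr) hX' hA hw2 q2 q5 q6
  have el : (l : ℝ) + X.card ≤ (X + X).card := by exact_mod_cast hl
  have hl1 : 100 * l ≤ 124 * X.card + 100 := by
    have : (100 * l : ℝ) ≤ 124 * X.card + 100 := by linarith
    exact_mod_cast this
  have hx1 : 1000 * X.card ≤ 33 * S.card := by
    have : (1000 * X.card : ℝ) ≤ 33 * S.card := by linarith
    exact_mod_cast this
  have hg1 : 10 * g ≤ 11 * X.card := by
    have : (10 * g : ℝ) ≤ 11 * X.card := by linarith
    exact_mod_cast this
  have hcard : X.card = A'.card := by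
    conv_lhs => rw [hXA]
    exact card_affineImage (u := 0) (w := l) hd (by simpa using hA'.subset)
      (by exact_mod_cast (show l < p by omega))
  have hwin : HasWindowGain A' l 3 (49 * X.card / 100) :=
    hA'.hasWindowGain_of_dense (by omega) (by omega)
  -- 3 · 0.49 = 1.47 beats 1.1, and the windows take up about 15 · 1.24 · 0.033|S| < 0.62|S|.
  obtain ⟨a, e, s, he, hs, hcov⟩ := exists_progression_of_hasWindowGain (M := 3) (g := g) (S := S)
    hA' hwin hd hXA (by omega) hGg (by omega) (by omega) (by omega) (by omega)
  exact ⟨a, e, s, he, by omega, hcov⟩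

end SmallDoubling

theorem theorem1p2 (p : ℕ) (hp : p.Prime) (hp0 : 2 ^ 94 < p)
    (S : Finset (ZMod p))
    (hS : ((S + S).card : ℝ) < (2 + 1 / 10 ^ 4) * (S.card : ℝ))
    (m : ℤ) (hm : m = ((S + S).card : ℤ) - 2 * (S.card : ℤ))
    (hm_lower : -1 ≤ m)
    (hm_upper : m ≤ min ((S.card : ℤ) - 4) ((p : ℤ) - ((S + S).card : ℤ) - 3)) :
    ∃ (n : ℕ) (P : Finset (ZMod p)),
      (n : ℤ) = (S.card : ℤ) + m + 1 ∧ IsArithProgOfLength P n ∧ S ⊆ P := by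
  have : Fact p.Prime := ⟨hp⟩
  have h1 := hm_upper.trans (min_le_left _ _)
  have h2 := hm_upper.trans (min_le_right _ _)
  have h3 : 10000 * (S + S).card < 20001 * S.card := by
    have : (10000 * (S + S).card : ℝ) < 20001 * S.card := by
      norm_num at hS
      linarith
    exact_mod_cast this
  have hpbig : 10 ^ 20 < p := lt_of_le_of_lt (by norm_num) hp0
  have key : IsCoveredByProgression S ((S + S).card - S.card) := by
    by_cases c1 : S.card ≤ 47
    · exact isCoveredByProgression_of_card_le S c1 hp0 (by omega) (by omega)
    by_cases c2 : 200 * S.card ≤ p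
    · exact isCoveredByProgression_of_sparse S (by omega) (by omega) c2 h3.le
    by_cases c3 : 1000 * (p - (S + S).card) < S.card
    · exact isCoveredByProgression_of_card_compl_small S (by omega) (by omega) (by omega) c3
    · exact isCoveredByProgression_of_card_compl_large S (by omega) h3.le (by omega) (by omega)
        (by omega)
  obtain ⟨a, e, s, he, hs, hcov⟩ := key
  -- Indeed |2S| - |S| + 1 = |S| + m + 1, and this is at most p, so the terms are distinct.
  obtain ⟨P, hP, hSP⟩ := exists_isArithProgOfLength (N := (S + S).card - S.card + 1) he hcov
    (by omega) (by omega)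
  exact ⟨_, P, by omega, hP, hSP⟩
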